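/- Let $K$ be a field and let $l,m,n$ be positive integers with $2\le m\le n$, $l\mid n$ and $l\le\min\{m-1,\frac n2\}$. Let $R=K[x_1,\dots,x_n]$ with the standard grading, read the indices of the variables modulo $n$, and put $k=n/l$. Let $$I=I_{m,l}(C_n)=(u_1,\dots,u_k)\subseteq R,\qquad u_i=\prod_{j=1}^{m}x_{(i-1)l+j}\quad(1\le i\le k),$$ be the path ideal of the $n$-cycle $C_n$. Write $m=tl+s$ with integers $t$ and $0\le s<l$, and $k=p(t+1)+d$ with integers $p\ge 0$ and $0\le d\le t$. Let $\beta_{i,j}$ denote the graded Betti numbers of $R/I$, that is, $F_i=\bigoplus_j R(-j)^{\beta_{i,j}}$ is the $i$-th module of the minimal graded free resolution $\cdots\to F_1\to F_0\to R/I\to 0$, and put $$\mathrm{pd}(R/I)=\max\{i\mid \beta_{i,j}\ne 0\text{ for some }j\},\qquad \mathrm{reg}(R/I)=\max\{j-i\mid \beta_{i,j}\neq 0\}.$$ Then $$\mathrm{pd}(R/I)=\begin{cases}2p,&\text{if } d=0,\\ 2p+1,&\text{if } d\ne 0,\end{cases}\qquad \mathrm{reg}(R/I)=\begin{cases}n-2p,&\text{if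 } d=0,\\ n-2p-1,&\text{if } d\neq 0.\end{cases}$$ -/

import Mathlib

open MvPolynomial

/-- The path ideal `I_{m,l}(C_n)` of the `n`-cycle on the variables `x_a`, `a ∈ ℤ/n`.
It is generated by `u_i = ∏_{j = 1}^{m} x_{(i-1)l+j}` for `1 ≤ i ≤ k`, `k = n / gcd(l, n)`.
The index `i - 1` is the `i : Fin k` below, and indices of variables are read modulo `n`. -/
noncomputable def pathIdeal (K : Type*) [Field K] (m l n : ℕ) :
    Ideal (MvPolynomial (ZMod n) K) :=
  Ideal.span (Set.range fun i : Fin (n / Nat.gcd l n) =>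
    ∏ j ∈ Finset.Icc 1 m, X (((i : ℕ) * l + j : ℕ) : ZMod n))

/-- A minimal graded free resolution
`⋯ ⟶ F₂ ⟶ F₁ ⟶ F₀ ⟶ R/I ⟶ 0` of `R/I`, where `R = K[x_a : a ∈ σ]` has the standard grading.
The module `F_i` is free of finite rank with the basis `Pi.single c 1`, `c : Fin (rank i)`, whose
elements have degrees `shift i c`, so that `F_i = ⨁_c R(-shift i c)`. The modules `F_i` may be
zero. No bound on the length is required. -/
structure MinimalGradedFreeResolution {K σ : Type*} [Field K]
    (I : Ideal (MvPolynomial σ K)) where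
  /-- the rank of `F_i` -/
  rank : ℕ → ℕ
  /-- the degrees of the basis elements of `F_i` -/
  shift : (i : ℕ) → Fin (rank i) → ℕ
  /-- the differential `F_{i+1} ⟶ F_i` -/
  d : (i : ℕ) → (Fin (rank (i + 1)) → MvPolynomial σ K) →ₗ[MvPolynomial σ K]
    (Fin (rank i) → MvPolynomial σ K)
  /-- the augmentation `F₀ ⟶ R/I` -/
  aug : (Fin (rank 0) → MvPolynomial σ K) →ₗ[MvPolynomial σ K] (MvPolynomial σ K ⧸ I)
  /-- The differentials preserve degrees: every monomial `x^u` in the `r`-th coordinate of the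
  image of the `c`-th basis element has `deg u + shift i r = shift (i + 1) c`. -/
  d_graded : ∀ (i : ℕ) (c : Fin (rank (i + 1))) (r : Fin (rank i)) (u : σ →₀ ℕ),
    coeff u (d i (Pi.single c 1) r) ≠ 0 → u.degree + shift i r = shift (i + 1) c
  /-- The augmentation preserves degrees. -/
  aug_graded : ∀ c : Fin (rank 0), ∃ f : MvPolynomial σ K,
    f.IsHomogeneous (shift 0 c) ∧ aug (Pi.single c 1) = Ideal.Quotient.mk I f
  aug_surjective : Function.Surjective aug
  exact_zero : Function.Exact (d 0) aug
  exact_succ : ∀ i : ℕ, Function.Exact (d (i + 1)) (d i)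
  /-- Minimality: all matrix entries of the differentials lie in the ideal generated by the
  variables, that is, they have no constant term. -/
  minimal : ∀ (i : ℕ) (c : Fin (rank (i + 1))) (r : Fin (rank i)),
    constantCoeff (d i (Pi.single c 1) r) = 0

/-- The graded Betti number `β_{i,j}`: the number of summands `R(-j)` in `F_i`. -/
def MinimalGradedFreeResolution.betti {K σ : Type*} [Field K] {I : Ideal (MvPolynomial σ K)}
    (F : MinimalGradedFreeResolution I) (i j : ℕ) : ℕ :=
  (Finset.univ.filter fun c : Fin (F.rank i) => F.shift i c = j).card

/-! Let `P` be the claimed projective dimension; the claimed regularity is `n - P`. It suffices to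
have some graded free resolution of `R/I`, minimal or not, whose basis elements occupy positions (i,
j) (homological and internal degree) with i ≤ P and j - i ≤ n - P, and among them (P, n). Every
position of a minimal resolution occurs in any other one (`mem_of_betti_ne_zero`), which gives both
upper bounds. The bounds leave (P, n) as the only position of internal degree n, so nothing cancels
there (`betti_ne_zero_of_isolated`), and this one Betti number attains both maxima.

The resolution is an iterated mapping cone. Adding a monomial u to a squarefree monomial ideal J
joins a resolution of `R/J` to one of `R/(J : u)` shifted by (1, deg u) (`hasResolution_insert`),
and J : u arises by deleting the variables of u from the generators of J. Deleting a window cuts the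
cycle open, so the colon ideals live on a line: an interval [x, y), followed by the windows that
start at multiples of l beyond x, cut off at n. Such families are closed under the same step with
[x, y) added last. Without it, the next window [x', y') becomes the first interval; the colon by it
is the unit ideal or a family with first interval [y, y').

Let a and b count the multiples of l in (x, n] and (y, n], and put T = t + 1. The recursion is (a,
b) ↦ (a - 1, a - T), (b, a - T), and the bounds depend on the blocks (cT, cT + T] that contain a and
b (`lineBounds_step`). This is the source of the division of k by t + 1. `LineBound.cycle_bound`
carries the bounds over to the cycle, and `exists_cycle_resolution` assembles the resolution. -/

/-! ### Graded maps between free modules over the polynomial ring. -/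

section GradedFree

variable {K σ : Type*} [Field K]

/-- The vector `v` of the free module with basis degrees `w` is homogeneous of degree `j`. -/
def HasDegree {ι : Type*} (w : ι → ℕ) (j : ℕ) (v : ι → MvPolynomial σ K) : Prop :=
  ∀ c u, coeff u (v c) ≠ 0 → u.degree + w c = j

/-- A linear map of free modules that preserves degrees. -/
def IsGradedMap {ι κ : Type*} [DecidableEq ι] (w : ι → ℕ) (w' : κ → ℕ)
    (φ : (ι → MvPolynomial σ K) →ₗ[MvPolynomial σ K] (κ → MvPolynomial σ K)) : Prop :=
  ∀ c, HasDegree w' (w c) (φ (Pi.single c 1))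

/-- The homogeneous component of degree `j` of a vector of the free module with basis
degrees `w`. -/
noncomputable def component {ι : Type*} (w : ι → ℕ) (j : ℕ) (v : ι → MvPolynomial σ K) :
    ι → MvPolynomial σ K :=
  fun c => if w c ≤ j then homogeneousComponent (j - w c) (v c) else 0

theorem coeff_component {ι : Type*} (w : ι → ℕ) (j : ℕ) (v : ι → MvPolynomial σ K) (c : ι)
    (u : σ →₀ ℕ) :
    coeff u (component w j v c) = if u.degree + w c = j then coeff u (v c) else 0 := by
  unfold component
  by_cases h : w c ≤ j
  · rw [if_pos h, coeff_homogeneousComponent]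
    by_cases h' : u.degree + w c = j
    · rw [if_pos h', if_pos (by omega)]
    · rw [if_neg h', if_neg (by omega)]
  · rw [if_neg h, if_neg (by omega), coeff_zero]

theorem hasDegree_component {ι : Type*} (w : ι → ℕ) (j : ℕ) (v : ι → MvPolynomial σ K) :
    HasDegree w j (component w j v) := by
  intro c u h
  rw [coeff_component] at h
  by_contra h'
  exact h (if_neg h')

theorem HasDegree.component_eq {ι : Type*} {w : ι → ℕ} {j : ℕ} {v : ι → MvPolynomial σ K}
    (h : HasDegree w j v) : component w j v = v := by
  funext c
  ext u
  rw [coeff_component]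
  split_ifs with h'
  · rfl
  · by_contra h0
    exact h' (h c u (Ne.symm h0))

theorem sum_component {ι : Type*} [Finite ι] (w : ι → ℕ) (v : ι → MvPolynomial σ K) :
    ∃ N, v = ∑ j ∈ Finset.range N, component w j v := by
  cases nonempty_fintype ι
  refine ⟨(∑ c, (w c + (v c).totalDegree)) + 1, ?_⟩
  funext c
  ext u
  rw [Finset.sum_apply, coeff_sum]
  simp_rw [coeff_component]
  rw [Finset.sum_ite_eq]
  split_ifs with h
  · rfl
  · by_contra h0
    apply h
    have h1 : u.degree ≤ (v c).totalDegree := by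
      have := le_totalDegree (mem_support_iff.2 h0)
      exact this
    have h2 := Finset.single_le_sum (f := fun c => w c + (v c).totalDegree)
      (fun _ _ => Nat.zero_le _) (Finset.mem_univ c)
    rw [Finset.mem_range]
    omega

theorem linearMap_apply_eq_sum {ι κ R : Type*} [CommSemiring R] [Fintype ι] [DecidableEq ι]
    (φ : (ι → R) →ₗ[R] (κ → R)) (v : ι → R) (r : κ) :
    φ v r = ∑ c, v c * φ (Pi.single c 1) r := by
  conv_lhs => rw [LinearMap.pi_apply_eq_sum_univ φ v]
  simp only [Finset.sum_apply, Pi.smul_apply, smul_eq_mul]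
  refine Finset.sum_congr rfl fun c _ => ?_
  have h : (fun j => if c = j then (1 : R) else 0) = Pi.single c 1 := by
    funext j
    simp [Pi.single_apply, eq_comm]
  rw [h]

/-- A nonzero coefficient of a matrix entry fixes the difference of the degrees, so in each product
the degree condition at the source and the one at the target select the same terms. -/
theorem IsGradedMap.map_component {ι κ : Type*} [Fintype ι] [DecidableEq ι] {w : ι → ℕ}
    {w' : κ → ℕ} {φ : (ι → MvPolynomial σ K) →ₗ[MvPolynomial σ K] (κ → MvPolynomial σ K)}
    (hφ : IsGradedMap w w' φ) (j : ℕ) (v : ι → MvPolynomial σ K) :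
    φ (component w j v) = component w' j (φ v) := by
  classical
  funext r
  ext u
  rw [coeff_component, linearMap_apply_eq_sum φ v, linearMap_apply_eq_sum φ, coeff_sum, coeff_sum]
  simp_rw [coeff_mul]
  split_ifs with hu
  · refine Finset.sum_congr rfl fun c _ => Finset.sum_congr rfl fun ab hab => ?_
    rw [coeff_component]
    split_ifs with h
    · rfl
    · rw [zero_mul, eq_comm, mul_eq_zero, or_iff_not_imp_right]
      intro hb
      have h1 := hφ c r ab.2 hb
      have h2 := congrArg Finsupp.degree (Finset.HasAntidiagonal.mem_antidiagonal.1 hab)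
      rw [map_add] at h2
      omega
  · refine Finset.sum_eq_zero fun c _ => Finset.sum_eq_zero fun ab hab => ?_
    rw [coeff_component, mul_eq_zero, or_iff_not_imp_right]
    intro hb
    have h1 := hφ c r ab.2 hb
    have h2 := congrArg Finsupp.degree (Finset.HasAntidiagonal.mem_antidiagonal.1 hab)
    rw [map_add] at h2
    exact if_neg (by omega)

theorem HasDegree.map {ι κ : Type*} [Fintype ι] [DecidableEq ι] {w : ι → ℕ}
    {w' : κ → ℕ} {φ : (ι → MvPolynomial σ K) →ₗ[MvPolynomial σ K] (κ → MvPolynomial σ K)}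
    (hφ : IsGradedMap w w' φ) {j : ℕ} {v : ι → MvPolynomial σ K} (hv : HasDegree w j v) :
    HasDegree w' j (φ v) := by
  rw [← hv.component_eq, hφ.map_component]
  exact hasDegree_component _ _ _

theorem IsGradedMap.comp {ι κ τ : Type*} [DecidableEq ι] [Fintype κ] [DecidableEq κ]
    {w : ι → ℕ} {w' : κ → ℕ} {w'' : τ → ℕ}
    {φ : (ι → MvPolynomial σ K) →ₗ[MvPolynomial σ K] (κ → MvPolynomial σ K)}
    {ψ : (κ → MvPolynomial σ K) →ₗ[MvPolynomial σ K] (τ → MvPolynomial σ K)}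
    (hψ : IsGradedMap w' w'' ψ) (hφ : IsGradedMap w w' φ) : IsGradedMap w w'' (ψ ∘ₗ φ) :=
  fun c => HasDegree.map hψ (hφ c)

/-- A linear map from a free module with prescribed values on the basis. -/
theorem exists_linearMap {ι M R : Type*} [CommSemiring R] [AddCommMonoid M] [Module R M]
    [Fintype ι] [DecidableEq ι] (P : ι → M → Prop) (h : ∀ c, ∃ x, P c x) :
    ∃ φ : (ι → R) →ₗ[R] M, ∀ c, P c (φ (Pi.single c 1)) := by
  choose f hf using h
  refine ⟨(Pi.basisFun R ι).constr R f, fun c => ?_⟩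
  have := (Pi.basisFun R ι).constr_basis R f c
  rw [Pi.basisFun_apply] at this
  rw [this]
  exact hf c

theorem linearMap_ext_single {ι M R : Type*} [CommSemiring R] [AddCommMonoid M] [Module R M]
    [Fintype ι] [DecidableEq ι] {φ ψ : (ι → R) →ₗ[R] M}
    (h : ∀ c, φ (Pi.single c 1) = ψ (Pi.single c 1)) : φ = ψ :=
  (Pi.basisFun R ι).ext fun c => by simpa using h c

/-- A graded map into the image of a graded map lifts to a graded map. -/
theorem IsGradedMap.exists_lift {ι κ τ : Type*} [Fintype ι] [DecidableEq ι] [Fintype τ]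
    [DecidableEq τ] {w : ι → ℕ} {w' : κ → ℕ} {w'' : τ → ℕ}
    {φ : (ι → MvPolynomial σ K) →ₗ[MvPolynomial σ K] (κ → MvPolynomial σ K)}
    {ψ : (τ → MvPolynomial σ K) →ₗ[MvPolynomial σ K] (κ → MvPolynomial σ K)}
    (hφ : IsGradedMap w w' φ) (hψ : IsGradedMap w'' w' ψ) (h : ∀ v, ∃ x, φ x = ψ v) :
    ∃ χ : (τ → MvPolynomial σ K) →ₗ[MvPolynomial σ K] (ι → MvPolynomial σ K),
      IsGradedMap w'' w χ ∧ φ ∘ₗ χ = ψ := by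
  obtain ⟨χ, hχ⟩ := exists_linearMap (R := MvPolynomial σ K)
    (fun (c : τ) (x : ι → MvPolynomial σ K) => HasDegree w (w'' c) x ∧ φ x = ψ (Pi.single c 1))
    (fun c => by
      obtain ⟨x, hx⟩ := h (Pi.single c 1)
      refine ⟨component w (w'' c) x, hasDegree_component _ _ _, ?_⟩
      rw [hφ.map_component, hx, (hψ c).component_eq])
  exact ⟨χ, fun c => (hχ c).1, linearMap_ext_single fun c => (hχ c).2⟩

end GradedFree

/-! ### Comparison of graded free resolutions. -/

section Resolutions

variable {K σ : Type*} [Field K]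

/-- A graded free resolution of `R/I`, not necessarily minimal, with finite bases `ι i` of
degrees `w i`. The augmentation is lifted to `R`, the free module on `Unit`. -/
structure GradedFreeResolution (I : Ideal (MvPolynomial σ K)) where
  ι : ℕ → Type
  fintype : ∀ i, Fintype (ι i)
  decEq : ∀ i, DecidableEq (ι i)
  w : ∀ i, ι i → ℕ
  d : ∀ i, (ι (i + 1) → MvPolynomial σ K) →ₗ[MvPolynomial σ K] (ι i → MvPolynomial σ K)
  aug : (ι 0 → MvPolynomial σ K) →ₗ[MvPolynomial σ K] (Unit → MvPolynomial σ K)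
  d_graded : ∀ i, IsGradedMap (w (i + 1)) (w i) (d i)
  aug_graded : IsGradedMap (w 0) (fun _ => 0) aug
  aug_surjective : ∀ f, ∃ x, aug x () - f ∈ I
  exact_zero : ∀ x, aug x () ∈ I ↔ ∃ y, d 0 y = x
  exact_succ : ∀ i x, d i x = 0 ↔ ∃ y, d (i + 1) y = x

attribute [instance] GradedFreeResolution.fintype GradedFreeResolution.decEq

/-- Dependent choice with a link `Q` between neighbours. Chain maps, homotopies and minimal
resolutions are built with it, one homological degree at a time. -/
theorem exists_dependent_sequence {X : ℕ → Type*} (P : ∀ i, X i → Prop)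
    (Q : ∀ i, X i → X (i + 1) → Prop) (x₀ : X 0) (h₀ : P 0 x₀)
    (step : ∀ i x, P i x → ∃ y, P (i + 1) y ∧ Q i x y) :
    ∃ s : ∀ i, X i, s 0 = x₀ ∧ (∀ i, P i (s i)) ∧ ∀ i, Q i (s i) (s (i + 1)) := by
  choose next hP hQ using step
  let s : ∀ i, {x : X i // P i x} := fun i =>
    Nat.rec ⟨x₀, h₀⟩ (fun i x => ⟨next i x.1 x.2, hP i x.1 x.2⟩) i
  exact ⟨fun i => (s i).1, rfl, fun i => (s i).2, fun i => hQ i (s i).1 (s i).2⟩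

theorem HasDegree.shift {ι : Type*} {w : ι → ℕ} {j : ℕ} {v : ι → MvPolynomial σ K}
    (h : HasDegree w j v) (e : ℕ) : HasDegree (fun c => w c + e) (j + e) v :=
  fun c u hu => by
    rw [← h c u hu, add_assoc]

theorem IsGradedMap.shift {ι κ : Type*} [DecidableEq ι] {w : ι → ℕ} {w' : κ → ℕ}
    {φ : (ι → MvPolynomial σ K) →ₗ[MvPolynomial σ K] (κ → MvPolynomial σ K)}
    (h : IsGradedMap w w' φ) (e : ℕ) :
    IsGradedMap (fun c => w c + e) (fun c => w' c + e) φ :=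
  fun c => (h c).shift e

namespace GradedFreeResolution

variable {I I' : Ideal (MvPolynomial σ K)}

theorem d_comp_d (X : GradedFreeResolution I) (i : ℕ) (x : X.ι (i + 2) → MvPolynomial σ K) :
    X.d i (X.d (i + 1) x) = 0 :=
  (X.exact_succ i _).2 ⟨x, rfl⟩

theorem aug_d_mem (X : GradedFreeResolution I) (x : X.ι 1 → MvPolynomial σ K) :
    X.aug (X.d 0 x) () ∈ I :=
  (X.exact_zero _).2 ⟨x, rfl⟩

theorem exists_homogeneous_aug (Y : GradedFreeResolution I)
    (hI : ∀ f ∈ I, ∀ j, homogeneousComponent j f ∈ I) {f : MvPolynomial σ K} {j : ℕ}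
    (hf : f.IsHomogeneous j) : ∃ x, HasDegree (Y.w 0) j x ∧ Y.aug x () - f ∈ I := by
  obtain ⟨x, hx⟩ := Y.aug_surjective f
  refine ⟨component (Y.w 0) j x, hasDegree_component _ _ _, ?_⟩
  have h := hI _ hx j
  rw [map_sub, homogeneousComponent_eq_self hf] at h
  rw [Y.aug_graded.map_component]
  simpa [component] using h

/-- Multiplication by `a`, as a map `R/I' ⟶ R/I`, lifts to a graded chain map. -/
theorem exists_chainMap (X : GradedFreeResolution I') (Y : GradedFreeResolution I)
    (hI : ∀ f ∈ I, ∀ j, homogeneousComponent j f ∈ I) {a : MvPolynomial σ K} {e : ℕ}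
    (ha : a.IsHomogeneous e) (hmul : ∀ f ∈ I', a * f ∈ I) :
    ∃ f : ∀ i, (X.ι i → MvPolynomial σ K) →ₗ[MvPolynomial σ K] (Y.ι i → MvPolynomial σ K),
      (∀ i, IsGradedMap (fun c => X.w i c + e) (Y.w i) (f i)) ∧
      (∀ x, Y.aug (f 0 x) () - a * X.aug x () ∈ I) ∧
      ∀ i, Y.d i ∘ₗ f (i + 1) = f i ∘ₗ X.d i := by
  obtain ⟨f₀, hf₀⟩ := exists_linearMap (R := MvPolynomial σ K)
    (fun (c : X.ι 0) (y : Y.ι 0 → MvPolynomial σ K) => HasDegree (Y.w 0) (X.w 0 c + e) y ∧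
      Y.aug y () - a * X.aug (Pi.single c 1) () ∈ I) (fun c => by
        apply Y.exists_homogeneous_aug hI
        rw [add_comm]
        refine ha.mul fun u hu => ?_
        have := X.aug_graded c () u hu
        rw [add_zero] at this
        rw [← this, Finsupp.degree_eq_weight_one]
        rfl)
  have haug : ∀ x, Y.aug (f₀ x) () - a * X.aug x () ∈ I := by
    intro x
    have h : ∀ x, Y.aug (f₀ x) () - a * X.aug x () =
        ∑ c, x c * (Y.aug (f₀ (Pi.single c 1)) () - a * X.aug (Pi.single c 1) ()) := by
      intro x
      have h1 := linearMap_apply_eq_sum (Y.aug ∘ₗ f₀) x ()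
      have h2 := linearMap_apply_eq_sum X.aug x ()
      rw [LinearMap.comp_apply] at h1
      rw [h1, h2, Finset.mul_sum, ← Finset.sum_sub_distrib]
      refine Finset.sum_congr rfl fun c _ => ?_
      rw [LinearMap.comp_apply]
      ring
    rw [h]
    exact I.sum_mem fun c _ => I.mul_mem_left _ (hf₀ c).2
  -- The invariant says that `f ∘ X.d i` lands in the image of `Y.d i`, which is what the next lift
  -- requires.
  obtain ⟨f, hf0, hfP, hfQ⟩ := exists_dependent_sequence
    (X := fun i => (X.ι i → MvPolynomial σ K) →ₗ[MvPolynomial σ K] (Y.ι i → MvPolynomial σ K))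
    (fun i f => IsGradedMap (fun c => X.w i c + e) (Y.w i) f ∧
      ∀ x, ∃ y, Y.d i y = f (X.d i x))
    (fun i f g => Y.d i ∘ₗ g = f ∘ₗ X.d i) f₀
    ⟨fun c => (hf₀ c).1, fun x => (Y.exact_zero _).1 (by
      have h := I.add_mem (haug (X.d 0 x)) (hmul _ (X.aug_d_mem x))
      rwa [sub_add_cancel] at h)⟩
    (fun i f hf => by
      obtain ⟨g, hg, hcomm⟩ := (Y.d_graded i).exists_lift
        (hf.1.comp ((X.d_graded i).shift e)) hf.2
      refine ⟨g, ⟨hg, fun x => (Y.exact_succ i _).1 ?_⟩, hcomm⟩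
      have := LinearMap.congr_fun hcomm (X.d (i + 1) x)
      rw [LinearMap.comp_apply, LinearMap.comp_apply, X.d_comp_d, map_zero] at this
      exact this)
  subst hf0
  exact ⟨f, fun i => (hfP i).1, haug, hfQ⟩

/-- A chain map that is zero on the augmentation modules is null-homotopic. -/
theorem exists_homotopy (X : GradedFreeResolution I') (Y : GradedFreeResolution I)
    (φ : ∀ i, (X.ι i → MvPolynomial σ K) →ₗ[MvPolynomial σ K] (Y.ι i → MvPolynomial σ K))
    (hφ : ∀ i, Y.d i ∘ₗ φ (i + 1) = φ i ∘ₗ X.d i) (h0 : ∀ x, Y.aug (φ 0 x) () ∈ I) :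
    ∃ h : ∀ i, (X.ι i → MvPolynomial σ K) →ₗ[MvPolynomial σ K]
        (Y.ι (i + 1) → MvPolynomial σ K),
      φ 0 = Y.d 0 ∘ₗ h 0 ∧ ∀ i, φ (i + 1) = Y.d (i + 1) ∘ₗ h (i + 1) + h i ∘ₗ X.d i := by
  obtain ⟨h₀, hh₀⟩ := exists_linearMap (R := MvPolynomial σ K)
    (fun (c : X.ι 0) (y : Y.ι 1 → MvPolynomial σ K) => Y.d 0 y = φ 0 (Pi.single c 1))
    (fun c => (Y.exact_zero _).1 (h0 _))
  have e₀ : Y.d 0 ∘ₗ h₀ = φ 0 := linearMap_ext_single hh₀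
  obtain ⟨h, hh0, -, hQ⟩ := exists_dependent_sequence
    (X := fun i => (X.ι i → MvPolynomial σ K) →ₗ[MvPolynomial σ K]
      (Y.ι (i + 1) → MvPolynomial σ K))
    (fun i h => Y.d i ∘ₗ (φ (i + 1) - h ∘ₗ X.d i) = 0)
    (fun i h h' => φ (i + 1) = Y.d (i + 1) ∘ₗ h' + h ∘ₗ X.d i) h₀
    (by rw [LinearMap.comp_sub, ← LinearMap.comp_assoc, e₀, hφ, sub_self])
    (fun i h hP => by
      obtain ⟨h', hh'⟩ := exists_linearMap (R := MvPolynomial σ K)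
        (fun (c : X.ι (i + 1)) (y : Y.ι (i + 2) → MvPolynomial σ K) =>
          Y.d (i + 1) y = (φ (i + 1) - h ∘ₗ X.d i) (Pi.single c 1))
        (fun c => (Y.exact_succ i _).1 (LinearMap.congr_fun hP _))
      have e : Y.d (i + 1) ∘ₗ h' = φ (i + 1) - h ∘ₗ X.d i := linearMap_ext_single hh'
      refine ⟨h', ?_, by rw [e, sub_add_cancel]⟩
      rw [LinearMap.comp_sub, ← LinearMap.comp_assoc, e, hφ, LinearMap.sub_comp,
        LinearMap.comp_assoc, sub_sub_cancel]
      ext1 c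
      ext1
      simp [X.d_comp_d])
  subst hh0
  exact ⟨h, e₀.symm, hQ⟩

theorem constantCoeff_apply_eq_zero {ι κ : Type*} [Fintype ι] [DecidableEq ι]
    (φ : (ι → MvPolynomial σ K) →ₗ[MvPolynomial σ K] (κ → MvPolynomial σ K))
    (v : ι → MvPolynomial σ K) (r : κ)
    (h : ∀ c, constantCoeff (v c) = 0 ∨ constantCoeff (φ (Pi.single c 1) r) = 0) :
    constantCoeff (φ v r) = 0 := by
  rw [linearMap_apply_eq_sum, map_sum]
  refine Finset.sum_eq_zero fun c _ => ?_
  rw [map_mul, mul_eq_zero]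
  exact h c

/-- A basis element that splits off no trivial complex has a counterpart of the same degree in
every other graded free resolution. -/
theorem exists_same_degree (X Y : GradedFreeResolution I)
    (hI : ∀ f ∈ I, ∀ j, homogeneousComponent j f ∈ I) (i : ℕ) (c : X.ι i)
    (hto : ∀ c', constantCoeff (X.d i (Pi.single c' 1) c) = 0)
    (hfrom : ∀ i' (hi : i' + 1 = i) c', constantCoeff (X.d i' (Pi.single (hi ▸ c) 1) c') = 0) :
    ∃ c', Y.w i c' = X.w i c := by
  -- The composite `g ∘ f` is homotopic to the identity. In the entry (c, c) the homotopy terms have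
  -- no constant term, by `hto` and `hfrom`, so `g ∘ f` has constant term 1 there. A constant term
  -- can only pass through a basis element of `Y` of the same degree.
  obtain ⟨f, hfg, hfa, hfd⟩ := X.exists_chainMap Y hI (isHomogeneous_one σ K)
    (fun f hf => by rwa [one_mul])
  obtain ⟨g, -, hga, hgd⟩ := Y.exists_chainMap X hI (isHomogeneous_one σ K)
    (fun f hf => by rwa [one_mul])
  obtain ⟨h, h0, hs⟩ := exists_homotopy X X (fun i => LinearMap.id - g i ∘ₗ f i)
    (fun i => by
      rw [LinearMap.comp_sub, ← LinearMap.comp_assoc, hgd, LinearMap.comp_assoc, hfd,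
        LinearMap.sub_comp]
      rfl)
    (fun x => by
      have h1 := I.add_mem (hfa x) (hga (f 0 x))
      rw [one_mul, one_mul] at h1
      have h2 := I.neg_mem h1
      simp only [LinearMap.sub_apply, LinearMap.id_apply, LinearMap.comp_apply, map_sub,
        Pi.sub_apply]
      convert h2 using 1
      ring)
  by_contra hno
  push Not at hno
  have hgf : constantCoeff (g i (f i (Pi.single c 1)) c) = 0 := by
    refine constantCoeff_apply_eq_zero _ _ _ fun c' => Or.inl ?_
    by_contra hne
    have := hfg i c c' 0 hne
    simp only [map_zero] at this
    exact hno c' (by omega)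
  have hdh : ∀ x, constantCoeff (X.d i x c) = 0 := fun x =>
    constantCoeff_apply_eq_zero _ _ _ fun c' => Or.inr (hto c')
  have key : constantCoeff (((LinearMap.id : (X.ι i → MvPolynomial σ K) →ₗ[MvPolynomial σ K]
      (X.ι i → MvPolynomial σ K)) - g i ∘ₗ f i) (Pi.single c 1) c) = 0 := by
    cases i with
    | zero =>
      rw [h0]
      exact hdh _
    | succ i =>
      rw [hs, LinearMap.add_apply, Pi.add_apply, map_add, LinearMap.comp_apply, hdh, zero_add,
        LinearMap.comp_apply]
      exact constantCoeff_apply_eq_zero _ _ _ fun c' => Or.inl (hfrom i rfl c')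
  rw [LinearMap.sub_apply, Pi.sub_apply, map_sub, LinearMap.comp_apply, hgf] at key
  simp at key

end GradedFreeResolution

end Resolutions

/-! ### Mapping cones and the positions of their basis elements. -/

section MappingCone

/-- The map `(x, y) ↦ A x + F y` on a free module on a sum of bases. -/
noncomputable def sumDesc {α β M R : Type*} [CommRing R] [AddCommGroup M] [Module R M]
    (A : (α → R) →ₗ[R] M) (F : (β → R) →ₗ[R] M) : (α ⊕ β → R) →ₗ[R] M :=
  A ∘ₗ LinearMap.funLeft R R Sum.inl + F ∘ₗ LinearMap.funLeft R R Sum.inr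

/-- The map `(x, y) ↦ (A x + F y, -B y)`. -/
noncomputable def coneMap {α β γ δ R : Type*} [CommRing R] (A : (α → R) →ₗ[R] (γ → R))
    (F : (β → R) →ₗ[R] (γ → R)) (B : (β → R) →ₗ[R] (δ → R)) : (α ⊕ β → R) →ₗ[R] (γ ⊕ δ → R) :=
  (LinearEquiv.sumArrowLequivProdArrow γ δ R R).symm.toLinearMap ∘ₗ
    (sumDesc A F).prod (-(B ∘ₗ LinearMap.funLeft R R Sum.inr))

theorem sumDesc_elim {α β M R : Type*} [CommRing R] [AddCommGroup M] [Module R M]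
    (A : (α → R) →ₗ[R] M) (F : (β → R) →ₗ[R] M) (x : α → R) (y : β → R) :
    sumDesc A F (Sum.elim x y) = A x + F y :=
  rfl

theorem coneMap_elim {α β γ δ R : Type*} [CommRing R] (A : (α → R) →ₗ[R] (γ → R))
    (F : (β → R) →ₗ[R] (γ → R)) (B : (β → R) →ₗ[R] (δ → R)) (x : α → R) (y : β → R) :
    coneMap A F B (Sum.elim x y) = Sum.elim (A x + F y) (-(B y)) := by
  ext (c | c) <;> rfl

theorem single_inl {α β R : Type*} [CommRing R] [DecidableEq α] [DecidableEq β] (c : α) :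
    (Pi.single (Sum.inl c) 1 : α ⊕ β → R) = Sum.elim (Pi.single c 1) (0 : β → R) := by
  ext (b | b) <;> simp [Pi.single_apply]

theorem single_inr {α β R : Type*} [CommRing R] [DecidableEq α] [DecidableEq β] (c : β) :
    (Pi.single (Sum.inr c) 1 : α ⊕ β → R) = Sum.elim (0 : α → R) (Pi.single c 1) := by
  ext (b | b) <;> simp [Pi.single_apply]

theorem exists_eq_elim {α β R : Type*} (v : α ⊕ β → R) : ∃ x y, v = Sum.elim x y :=
  ⟨v ∘ Sum.inl, v ∘ Sum.inr, (Sum.elim_comp_inl_inr v).symm⟩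

variable {K σ : Type*} [Field K]

theorem isGradedMap_sumDesc {α β γ : Type*} [DecidableEq α] [DecidableEq β] {w : α → ℕ}
    {w' : β → ℕ} {w'' : γ → ℕ}
    {A : (α → MvPolynomial σ K) →ₗ[MvPolynomial σ K] (γ → MvPolynomial σ K)}
    {F : (β → MvPolynomial σ K) →ₗ[MvPolynomial σ K] (γ → MvPolynomial σ K)}
    (hA : IsGradedMap w w'' A) (hF : IsGradedMap w' w'' F) :
    IsGradedMap (Sum.elim w w') w'' (sumDesc A F) := by
  rintro (c | c)
  · rw [single_inl, sumDesc_elim, map_zero, add_zero]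
    exact hA c
  · rw [single_inr, sumDesc_elim, map_zero, zero_add]
    exact hF c

theorem isGradedMap_coneMap {α β γ δ : Type*} [DecidableEq α] [DecidableEq β] {w : α → ℕ}
    {w' : β → ℕ} {w'' : γ → ℕ} {w''' : δ → ℕ}
    {A : (α → MvPolynomial σ K) →ₗ[MvPolynomial σ K] (γ → MvPolynomial σ K)}
    {F : (β → MvPolynomial σ K) →ₗ[MvPolynomial σ K] (γ → MvPolynomial σ K)}
    {B : (β → MvPolynomial σ K) →ₗ[MvPolynomial σ K] (δ → MvPolynomial σ K)}
    (hA : IsGradedMap w w'' A) (hF : IsGradedMap w' w'' F) (hB : IsGradedMap w' w''' B) :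
    IsGradedMap (Sum.elim w w') (Sum.elim w'' w''') (coneMap A F B) := by
  rintro (c | c)
  · rw [single_inl, coneMap_elim, map_zero, map_zero, add_zero, neg_zero]
    rintro (r | r) u hu
    · exact hA c r u hu
    · simp at hu
  · rw [single_inr, coneMap_elim, map_zero, zero_add]
    rintro (r | r) u hu
    · exact hF c r u hu
    · refine hB c r u ?_
      simpa using hu

variable {I J : Ideal (MvPolynomial σ K)}

/-- The mapping cone of multiplication by `a`, as a map `R/J ⟶ R/I`, `J = I : a`. It resolves
`R/(I + (a))`. -/
noncomputable def GradedFreeResolution.cone (X : GradedFreeResolution I)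
    (Y : GradedFreeResolution J) (a : MvPolynomial σ K) (e : ℕ) (hJ : ∀ f, f ∈ J ↔ a * f ∈ I)
    (f : ∀ i, (Y.ι i → MvPolynomial σ K) →ₗ[MvPolynomial σ K] (X.ι i → MvPolynomial σ K))
    (hf : ∀ i, IsGradedMap (fun c => Y.w i c + e) (X.w i) (f i))
    (hfa : ∀ y, X.aug (f 0 y) () - a * Y.aug y () ∈ I)
    (hfd : ∀ i, X.d i ∘ₗ f (i + 1) = f i ∘ₗ Y.d i) :
    GradedFreeResolution (I ⊔ Ideal.span {a}) where
  ι
    | 0 => X.ι 0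
    | i + 1 => X.ι (i + 1) ⊕ Y.ι i
  fintype
    | 0 => X.fintype 0
    | i + 1 => inferInstanceAs (Fintype (X.ι (i + 1) ⊕ Y.ι i))
  decEq
    | 0 => X.decEq 0
    | i + 1 => inferInstanceAs (DecidableEq (X.ι (i + 1) ⊕ Y.ι i))
  w
    | 0 => X.w 0
    | i + 1 => Sum.elim (X.w (i + 1)) (fun c => Y.w i c + e)
  d
    | 0 => sumDesc (X.d 0) (f 0)
    | i + 1 => coneMap (X.d (i + 1)) (f (i + 1)) (Y.d i)
  aug := X.aug
  d_graded
    | 0 => isGradedMap_sumDesc (X.d_graded 0) (hf 0)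
    | i + 1 => isGradedMap_coneMap (X.d_graded (i + 1)) (hf (i + 1)) ((Y.d_graded i).shift e)
  aug_graded := X.aug_graded
  aug_surjective g := by
    obtain ⟨x, hx⟩ := X.aug_surjective g
    exact ⟨x, Ideal.mem_sup_left hx⟩
  exact_zero x := by
    constructor
    · intro h
      obtain ⟨g, hg, r, hr, hgr⟩ := Submodule.mem_sup.1 h
      obtain ⟨r', rfl⟩ := Ideal.mem_span_singleton'.1 hr
      obtain ⟨y, hy⟩ := Y.aug_surjective r'
      have h1 := (hJ _).1 hy
      have h2 : X.aug (x - f 0 y) () ∈ I := by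
        have h3 := I.sub_mem hg (I.add_mem (hfa y) h1)
        convert h3 using 1
        rw [map_sub, Pi.sub_apply, ← hgr]
        ring
      obtain ⟨z, hz⟩ := (X.exact_zero _).1 h2
      refine ⟨Sum.elim z y, ?_⟩
      change sumDesc (X.d 0) (f 0) (Sum.elim z y) = x
      rw [sumDesc_elim, hz, sub_add_cancel]
    · rintro ⟨v, rfl⟩
      obtain ⟨z, y, rfl⟩ := exists_eq_elim v
      change X.aug (sumDesc (X.d 0) (f 0) (Sum.elim z y)) () ∈ _
      rw [sumDesc_elim, map_add, Pi.add_apply]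
      refine Ideal.add_mem _ (Ideal.mem_sup_left (X.aug_d_mem z)) ?_
      have h := Ideal.add_mem _ (Ideal.mem_sup_left (T := Ideal.span {a}) (hfa y))
        (Ideal.mem_sup_right (S := I)
          (Ideal.mul_mem_right (Y.aug y ()) _ (Ideal.mem_span_singleton_self a)))
      rwa [sub_add_cancel] at h
  exact_succ
    | 0, v => by
      obtain ⟨x, y, rfl⟩ := exists_eq_elim v
      change sumDesc (X.d 0) (f 0) (Sum.elim x y) = 0 ↔
        ∃ z, coneMap (X.d 1) (f 1) (Y.d 0) z = Sum.elim x y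
      rw [sumDesc_elim]
      constructor
      · intro h
        have h1 : Y.aug y () ∈ J := by
          rw [hJ]
          have h2 := I.sub_mem (X.aug_d_mem (-x)) (hfa y)
          rw [map_neg, ← eq_neg_of_add_eq_zero_right h, sub_sub_cancel] at h2
          exact h2
        obtain ⟨y', hy'⟩ := (Y.exact_zero _).1 h1
        have h3 : X.d 0 (x + f 1 y') = 0 := by
          have : X.d 0 (f 1 y') = f 0 (Y.d 0 y') := LinearMap.congr_fun (hfd 0) y'
          rw [map_add, this, hy', h]
        obtain ⟨x', hx'⟩ : ∃ x', X.d 1 x' = x + f 1 y' := (X.exact_succ 0 _).1 h3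
        -- The second coordinate of the cone differential is `-Y.d`, so the preimage of `y` enters
        -- with a minus sign.
        refine ⟨Sum.elim x' (-y'), ?_⟩
        rw [coneMap_elim, hx', map_neg, map_neg, neg_neg, hy', add_neg_cancel_right]
      · rintro ⟨z, hz⟩
        obtain ⟨x', y', rfl⟩ := exists_eq_elim z
        rw [coneMap_elim, Sum.elim_eq_iff] at hz
        obtain ⟨rfl, rfl⟩ := hz
        have h1 : X.d 0 (f 1 y') = f 0 (Y.d 0 y') := LinearMap.congr_fun (hfd 0) y'
        have h2 : X.d 0 (X.d 1 x') = 0 := X.d_comp_d 0 x'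
        rw [map_add, map_neg, h1, h2]
        abel
    | i + 1, v => by
      obtain ⟨x, y, rfl⟩ := exists_eq_elim v
      change coneMap (X.d (i + 1)) (f (i + 1)) (Y.d i) (Sum.elim x y) = 0 ↔
        ∃ z, coneMap (X.d (i + 2)) (f (i + 2)) (Y.d (i + 1)) z = Sum.elim x y
      have h0 : (0 : X.ι (i + 1) ⊕ Y.ι i → MvPolynomial σ K) =
          Sum.elim (0 : X.ι (i + 1) → MvPolynomial σ K) (0 : Y.ι i → MvPolynomial σ K) := by
        ext (c | c) <;> rfl
      rw [coneMap_elim, h0, Sum.elim_eq_iff, neg_eq_zero]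
      constructor
      · rintro ⟨h, h1⟩
        obtain ⟨y', hy'⟩ := (Y.exact_succ i _).1 h1
        have h3 : X.d (i + 1) (x + f (i + 2) y') = 0 := by
          have := LinearMap.congr_fun (hfd (i + 1)) y'
          rw [LinearMap.comp_apply, LinearMap.comp_apply, hy'] at this
          rw [map_add, this, h]
        obtain ⟨x', hx'⟩ := (X.exact_succ (i + 1) _).1 h3
        refine ⟨Sum.elim x' (-y'), ?_⟩
        rw [coneMap_elim, hx', map_neg, map_neg, neg_neg, hy', add_neg_cancel_right]
      · rintro ⟨z, hz⟩
        obtain ⟨x', y', rfl⟩ := exists_eq_elim z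
        rw [coneMap_elim, Sum.elim_eq_iff] at hz
        obtain ⟨rfl, rfl⟩ := hz
        have := LinearMap.congr_fun (hfd (i + 1)) y'
        rw [LinearMap.comp_apply, LinearMap.comp_apply] at this
        rw [map_add, map_neg, map_neg, this, X.d_comp_d (i + 1) x', Y.d_comp_d i y']
        exact ⟨by abel, neg_zero⟩

/-- `R/I` has a graded free resolution with basis elements exactly in the homological and
internal degrees `(i, j) ∈ S`. -/
def HasResolution (I : Ideal (MvPolynomial σ K)) (S : Set (ℕ × ℕ)) : Prop :=
  ∃ X : GradedFreeResolution I, ∀ i j, (i, j) ∈ S ↔ ∃ c, X.w i c = j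

/-- The cone resolves the last term of 0 → R/J(-e) → R/I → R/(I + (a)) → 0, where J = I : a. Nothing
is cancelled: positions once present stay present, at the price of minimality. -/
theorem hasResolution_sup_span {S S' : Set (ℕ × ℕ)} (hI : HasResolution I S)
    (hhom : ∀ f ∈ I, ∀ j, homogeneousComponent j f ∈ I) {a : MvPolynomial σ K} {e : ℕ}
    (ha : a.IsHomogeneous e) (hJ : HasResolution J S') (hcolon : ∀ f, f ∈ J ↔ a * f ∈ I) :
    HasResolution (I ⊔ Ideal.span {a}) (S ∪ (fun q : ℕ × ℕ => (q.1 + 1, q.2 + e)) '' S') := by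
  obtain ⟨X, hX⟩ := hI
  obtain ⟨Y, hY⟩ := hJ
  obtain ⟨f, hf, hfa, hfd⟩ := Y.exists_chainMap X hhom ha fun f hf => (hcolon f).1 hf
  refine ⟨X.cone Y a e hcolon f hf hfa hfd, ?_⟩
  intro i j
  have key : (i, j) ∈ (fun q : ℕ × ℕ => (q.1 + 1, q.2 + e)) '' S' ↔
      ∃ i' c, i' + 1 = i ∧ Y.w i' c + e = j := by
    constructor
    · rintro ⟨⟨i', j'⟩, hq, h⟩
      obtain ⟨c, rfl⟩ := (hY i' j').1 hq
      simp only [Prod.mk.injEq] at h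
      exact ⟨i', c, h⟩
    · rintro ⟨i', c, rfl, rfl⟩
      exact ⟨(i', Y.w i' c), (hY _ _).2 ⟨c, rfl⟩, rfl⟩
  rw [Set.mem_union, hX, key]
  cases i with
  | zero =>
    constructor
    · rintro (h | ⟨i', c, h, -⟩)
      · exact h
      · omega
    · exact Or.inl
  | succ i =>
    constructor
    · rintro (⟨c, h⟩ | ⟨i', c, h, h'⟩)
      · exact ⟨Sum.inl c, h⟩
      · obtain rfl : i' = i := by omega
        exact ⟨Sum.inr c, h'⟩
    · rintro ⟨c | c, h⟩
      · exact Or.inl ⟨c, h⟩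
      · exact Or.inr ⟨i, c, rfl, h⟩

theorem hasResolution_top : HasResolution (⊤ : Ideal (MvPolynomial σ K)) ∅ :=
  ⟨{  ι := fun _ => Empty
      fintype := fun _ => inferInstance
      decEq := fun _ => inferInstance
      w := fun _ _ => 0
      d := fun _ => 0
      aug := 0
      d_graded := fun _ c => c.elim
      aug_graded := fun c => c.elim
      aug_surjective := fun _ => ⟨0, trivial⟩
      exact_zero := fun _ => ⟨fun _ => ⟨0, Subsingleton.elim _ _⟩, fun _ => trivial⟩
      exact_succ := fun _ _ => ⟨fun _ => ⟨0, Subsingleton.elim _ _⟩,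
        fun _ => Subsingleton.elim _ _⟩ }, fun _ _ => ⟨False.elim, fun ⟨c, _⟩ => c.elim⟩⟩

theorem hasResolution_bot : HasResolution (⊥ : Ideal (MvPolynomial σ K)) {(0, 0)} :=
  ⟨{  ι := fun i => match i with
        | 0 => Unit
        | _ + 1 => Empty
      fintype := fun i => match i with
        | 0 => inferInstanceAs (Fintype Unit)
        | _ + 1 => inferInstanceAs (Fintype Empty)
      decEq := fun i => match i with
        | 0 => inferInstanceAs (DecidableEq Unit)
        | _ + 1 => inferInstanceAs (DecidableEq Empty)
      w := fun _ _ => 0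
      d := fun _ => 0
      aug := LinearMap.id
      d_graded := fun _ c => c.elim
      aug_graded := fun c r u hu => by
        classical
        rw [LinearMap.id_apply, Subsingleton.elim r c, Pi.single_eq_same, coeff_one] at hu
        have : u = 0 := by
          by_contra h
          exact hu (if_neg (Ne.symm h))
        simp [this]
      aug_surjective := fun f => ⟨fun _ => f, by simp⟩
      exact_zero := fun x => by
        rw [LinearMap.id_apply, Ideal.mem_bot]
        constructor
        · intro h
          exact ⟨0, by funext c; exact h.symm⟩
        · rintro ⟨y, rfl⟩
          rfl
      exact_succ := fun i x => match i with
        | 0 => ⟨fun _ => ⟨0, funext fun c => c.elim⟩, fun _ => rfl⟩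
        | _ + 1 => ⟨fun _ => ⟨0, funext fun c => c.elim⟩, fun _ => rfl⟩ }, by
    intro i j
    rw [Set.mem_singleton_iff, Prod.mk.injEq]
    cases i with
    | zero => exact ⟨fun h => ⟨(), h.2.symm⟩, fun ⟨_, h⟩ => ⟨rfl, h.symm⟩⟩
    | succ i => exact ⟨fun h => by omega, fun ⟨c, _⟩ => c.elim⟩⟩

end MappingCone

/-! ### Minimal resolutions: existence, and comparison with arbitrary ones. -/

section Minimal

variable {K σ : Type*} [Field K]

theorem component_zero {ι : Type*} (w : ι → ℕ) (j : ℕ) :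
    component w j (0 : ι → MvPolynomial σ K) = 0 :=
  HasDegree.component_eq fun c u hu => by simp at hu

/-- A finitely generated graded submodule has a finite family of homogeneous generators. -/
theorem exists_homogeneous_generators {ι : Type*} [Finite ι] (w : ι → ℕ)
    (N : Submodule (MvPolynomial σ K) (ι → MvPolynomial σ K)) (hfg : N.FG)
    (hN : ∀ v ∈ N, ∀ j, component w j v ∈ N) :
    ∃ (r : ℕ) (g : Fin r → ι → MvPolynomial σ K) (w' : Fin r → ℕ),
      (∀ c, HasDegree w (w' c) (g c)) ∧ Submodule.span (MvPolynomial σ K) (Set.range g) = N := by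
  classical
  obtain ⟨s, hs⟩ := hfg
  choose M hM using fun v : ι → MvPolynomial σ K => sum_component w v
  let T : Finset (ι → MvPolynomial σ K) :=
    s.biUnion fun v => (Finset.range (M v)).image fun j => component w j v
  have hT : ∀ x : T, ∃ j, HasDegree w j x.1 := by
    rintro ⟨x, hx⟩
    obtain ⟨v, -, hx⟩ := Finset.mem_biUnion.1 hx
    obtain ⟨j, -, rfl⟩ := Finset.mem_image.1 hx
    exact ⟨j, hasDegree_component _ _ _⟩
  choose deg hdeg using hT
  refine ⟨T.card, fun c => (T.equivFin.symm c).1, fun c => deg (T.equivFin.symm c),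
    fun c => hdeg _, ?_⟩
  have hrange : Set.range (fun c => (T.equivFin.symm c).1) = (T : Set (ι → MvPolynomial σ K)) := by
    ext x
    constructor
    · rintro ⟨c, rfl⟩
      exact (T.equivFin.symm c).2
    · intro hx
      exact ⟨T.equivFin ⟨x, hx⟩, by simp⟩
  rw [hrange]
  apply le_antisymm
  · rw [Submodule.span_le]
    intro x hx
    obtain ⟨v, hv, hx⟩ := Finset.mem_biUnion.1 hx
    obtain ⟨j, -, rfl⟩ := Finset.mem_image.1 hx
    exact hN v (hs ▸ Submodule.subset_span hv) j
  · rw [← hs, Submodule.span_le]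
    intro v hv
    rw [SetLike.mem_coe, hM v]
    refine Submodule.sum_mem _ fun j hj => Submodule.subset_span ?_
    exact Finset.mem_biUnion.2 ⟨v, hv, Finset.mem_image.2 ⟨j, hj, rfl⟩⟩

/-- A minimal homogeneous presentation of a graded submodule of a free module. -/
theorem exists_minimal_cover [Finite σ] {ι : Type*} [Finite ι] (w : ι → ℕ)
    (N : Submodule (MvPolynomial σ K) (ι → MvPolynomial σ K))
    (hN : ∀ v ∈ N, ∀ j, component w j v ∈ N) :
    ∃ (r : ℕ) (w' : Fin r → ℕ)
      (φ : (Fin r → MvPolynomial σ K) →ₗ[MvPolynomial σ K] (ι → MvPolynomial σ K)),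
      IsGradedMap w' w φ ∧ LinearMap.range φ = N ∧
        ∀ x, φ x = 0 → ∀ c, constantCoeff (x c) = 0 := by
  classical
  have hex := exists_homogeneous_generators w N (IsNoetherian.noetherian N) hN
  -- The number of homogeneous generators is taken least possible; a relation with a nonzero
  -- constant term would make one of them superfluous.
  obtain ⟨g, w', hg, hspan⟩ := Nat.find_spec hex
  have hmin := fun {k : ℕ} => Nat.find_min hex (m := k)
  generalize Nat.find hex = r at g w' hg hspan hmin
  obtain ⟨φ, hφ⟩ := exists_linearMap (R := MvPolynomial σ K)
    (fun (c : Fin r) (y : ι → MvPolynomial σ K) => y = g c) (fun c => ⟨_, rfl⟩)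
  have hsum : ∀ x, φ x = ∑ c, x c • g c := by
    intro x
    conv_lhs => rw [pi_eq_sum_univ' x]
    rw [map_sum]
    refine Finset.sum_congr rfl fun c _ => ?_
    rw [map_smul, ← hφ c]
  have hgr : IsGradedMap w' w φ := fun c => by rw [hφ c]; exact hg c
  refine ⟨r, w', φ, hgr, ?_, ?_⟩
  · rw [← hspan]
    ext y
    rw [LinearMap.mem_range, Submodule.mem_span_range_iff_exists_fun]
    simp_rw [hsum]
  · intro x hx c₀
    by_contra hne
    -- The component of degree `w' c₀` is still a relation, and its coefficient at `c₀` is reduced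
    -- to a nonzero constant, hence invertible.
    obtain ⟨y, hyx⟩ : ∃ y, y = component w' (w' c₀) x := ⟨_, rfl⟩
    have hy : φ y = 0 := by rw [hyx, hgr.map_component, hx, component_zero]
    have hy₀ : y c₀ = C (constantCoeff (x c₀)) := by
      ext u
      rw [hyx, coeff_component, coeff_C, constantCoeff_eq]
      by_cases hu : u = 0
      · subst hu
        simp
      · rw [if_neg (Ne.symm hu), if_neg]
        intro h
        exact hu ((Finsupp.degree_eq_zero_iff u).1 (by omega))
    obtain ⟨r, rfl⟩ : ∃ r', r = r' + 1 := ⟨r - 1, by have := c₀.2; omega⟩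
    refine hmin (Nat.lt_succ_self r) ⟨g ∘ c₀.succAbove, w' ∘ c₀.succAbove, fun c => hg _, ?_⟩
    rw [← hspan]
    apply le_antisymm
    · exact Submodule.span_mono (Set.range_comp_subset_range _ _)
    · rw [Submodule.span_le]
      rintro _ ⟨c, rfl⟩
      rcases eq_or_ne c c₀ with rfl | hc
      · rw [hsum, Fin.sum_univ_succAbove _ c, hy₀] at hy
        have h1 : (C (constantCoeff (x c))⁻¹ : MvPolynomial σ K) • ((C (constantCoeff (x c)) : MvPolynomial σ K) • g c) = g c := by
          rw [smul_smul, ← C_mul, inv_mul_cancel₀ hne, C_1, one_smul]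
        rw [SetLike.mem_coe, ← h1, eq_neg_of_add_eq_zero_left hy]
        refine Submodule.smul_mem _ _ (Submodule.neg_mem _ (Submodule.sum_mem _ fun i _ =>
          Submodule.smul_mem _ _ (Submodule.subset_span ⟨i, rfl⟩)))
      · obtain ⟨c', rfl⟩ := Fin.exists_succAbove_eq hc
        exact Submodule.subset_span ⟨c', rfl⟩

/-- A free module `R^rank` with basis degrees `deg`, and a submodule of it. -/
structure SyzygyStage (K σ : Type*) [Field K] where
  rank : ℕ
  deg : Fin rank → ℕ
  syz : Submodule (MvPolynomial σ K) (Fin rank → MvPolynomial σ K)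

/-- Proper homogeneous ideals have minimal graded free resolutions. -/
theorem nonempty_minimalGradedFreeResolution [Finite σ] (I : Ideal (MvPolynomial σ K))
    (hI : ∀ f ∈ I, ∀ j, homogeneousComponent j f ∈ I) (hproper : ∀ f ∈ I, constantCoeff f = 0) :
    Nonempty (MinimalGradedFreeResolution I) := by
  classical
  obtain ⟨s₀, h₀, aug, haug, hsurj, hker⟩ : ∃ s₀ : SyzygyStage K σ,
      ((∀ v ∈ s₀.syz, ∀ j, component s₀.deg j v ∈ s₀.syz) ∧
        ∀ v ∈ s₀.syz, ∀ c, constantCoeff (v c) = 0) ∧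
      ∃ aug : (Fin s₀.rank → MvPolynomial σ K) →ₗ[MvPolynomial σ K] (MvPolynomial σ K ⧸ I),
        (∀ c, ∃ f : MvPolynomial σ K, f.IsHomogeneous (s₀.deg c) ∧
          aug (Pi.single c 1) = Ideal.Quotient.mk I f) ∧
        Function.Surjective aug ∧ ∀ v, aug v = 0 ↔ v ∈ s₀.syz := by
    refine ⟨⟨1, fun _ => 0, Submodule.comap (LinearMap.proj 0) I⟩, ⟨?_, ?_⟩,
      I.mkQ ∘ₗ LinearMap.proj 0, ?_, ?_, ?_⟩
    · intro v hv j
      have := hI (v 0) hv j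
      simpa [component] using this
    · intro v hv c
      rw [Subsingleton.elim c 0]
      exact hproper _ hv
    · intro c
      refine ⟨1, isHomogeneous_one _ _, ?_⟩
      rw [Subsingleton.elim c 0, LinearMap.comp_apply, LinearMap.proj_apply, Pi.single_eq_same]
      rfl
    · exact (Submodule.mkQ_surjective I).comp fun f => ⟨fun _ => f, rfl⟩
    · intro v
      rw [LinearMap.comp_apply, Submodule.mkQ_apply, Submodule.Quotient.mk_eq_zero]
      rfl
  -- Each stage records the syzygies still to be covered. The absence of constant terms in them is
  -- the minimality of the next differential.
  obtain ⟨s, hs0, hP, hQ⟩ := exists_dependent_sequence (X := fun _ => SyzygyStage K σ)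
    (fun _ s => (∀ v ∈ s.syz, ∀ j, component s.deg j v ∈ s.syz) ∧
      ∀ v ∈ s.syz, ∀ c, constantCoeff (v c) = 0)
    (fun _ s s' => ∃ d : (Fin s'.rank → MvPolynomial σ K) →ₗ[MvPolynomial σ K]
      (Fin s.rank → MvPolynomial σ K), IsGradedMap s'.deg s.deg d ∧ LinearMap.range d = s.syz ∧
        ∀ v, d v = 0 ↔ v ∈ s'.syz) s₀ h₀ (by
      intro _ s hs
      obtain ⟨r, w', φ, hφ, hrange, hker⟩ := exists_minimal_cover s.deg s.syz hs.1
      refine ⟨⟨r, w', LinearMap.ker φ⟩, ⟨?_, fun v hv => hker v hv⟩, φ, hφ, hrange,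
        fun _ => Iff.rfl⟩
      intro v hv j
      rw [LinearMap.mem_ker, hφ.map_component, LinearMap.mem_ker.1 hv, component_zero])
  subst hs0
  choose d hd hrange hkerd using hQ
  exact ⟨{
    rank := fun i => (s i).rank
    shift := fun i => (s i).deg
    d := d
    aug := aug
    d_graded := fun i c r u hu => hd i c r u hu
    aug_graded := haug
    aug_surjective := hsurj
    exact_zero := fun v => by rw [hker, ← hrange]; rfl
    exact_succ := fun i v => by rw [hkerd, ← hrange]; rfl
    minimal := fun i c r => (hP i).2 _ (by rw [← hrange]; exact ⟨_, rfl⟩) r }⟩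

/-- Forgetting minimality, with a lift of the augmentation to `R`. -/
theorem MinimalGradedFreeResolution.exists_gradedFreeResolution
    {I : Ideal (MvPolynomial σ K)} (F : MinimalGradedFreeResolution I) :
    ∃ X : GradedFreeResolution I, ∃ e : ∀ i, X.ι i ≃ Fin (F.rank i),
      (∀ i c, X.w i c = F.shift i (e i c)) ∧
      ∀ i c r, constantCoeff (X.d i (Pi.single c 1) r) = 0 := by
  obtain ⟨aug, haug⟩ := exists_linearMap (R := MvPolynomial σ K)
    (fun (c : Fin (F.rank 0)) (y : Unit → MvPolynomial σ K) =>
      HasDegree (fun _ => 0) (F.shift 0 c) y ∧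
        Ideal.Quotient.mk I (y ()) = F.aug (Pi.single c 1)) (fun c => by
      obtain ⟨f, hf, hfc⟩ := F.aug_graded c
      refine ⟨fun _ => f, fun _ u hu => ?_, hfc.symm⟩
      have := hf hu
      rw [add_zero, Finsupp.degree_eq_weight_one]
      exact this)
  have hmk : ∀ x, Ideal.Quotient.mk I (aug x ()) = F.aug x := by
    have h : I.mkQ ∘ₗ LinearMap.proj () ∘ₗ aug = F.aug :=
      linearMap_ext_single fun c => (haug c).2
    exact fun x => LinearMap.congr_fun h x
  refine ⟨{
    ι := fun i => Fin (F.rank i)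
    fintype := fun _ => inferInstance
    decEq := fun _ => inferInstance
    w := F.shift
    d := F.d
    aug := aug
    d_graded := F.d_graded
    aug_graded := fun c => (haug c).1
    aug_surjective := fun f => ?_
    exact_zero := fun x => ?_
    exact_succ := fun i x => F.exact_succ i x }, fun i => Equiv.refl _, fun _ _ => rfl, F.minimal⟩
  · obtain ⟨x, hx⟩ := F.aug_surjective (Ideal.Quotient.mk I f)
    exact ⟨x, by rw [← Ideal.Quotient.mk_eq_mk_iff_sub_mem, hmk, hx]⟩
  · rw [← Ideal.Quotient.eq_zero_iff_mem, hmk]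
    exact F.exact_zero x

theorem MinimalGradedFreeResolution.betti_ne_zero_iff {I : Ideal (MvPolynomial σ K)}
    (F : MinimalGradedFreeResolution I) (i j : ℕ) : F.betti i j ≠ 0 ↔ ∃ c, F.shift i c = j := by
  unfold MinimalGradedFreeResolution.betti
  rw [Finset.card_ne_zero, Finset.filter_nonempty_iff]
  simp

/-- The nonzero Betti numbers are among the positions of every graded free resolution. -/
theorem MinimalGradedFreeResolution.mem_of_betti_ne_zero {I : Ideal (MvPolynomial σ K)}
    (F : MinimalGradedFreeResolution I) (hI : ∀ f ∈ I, ∀ j, homogeneousComponent j f ∈ I)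
    {S : Set (ℕ × ℕ)} (hS : HasResolution I S) {i j : ℕ} (h : F.betti i j ≠ 0) : (i, j) ∈ S := by
  obtain ⟨c, rfl⟩ := (F.betti_ne_zero_iff i j).1 h
  obtain ⟨X, e, hw, hmin⟩ := F.exists_gradedFreeResolution
  obtain ⟨Y, hY⟩ := hS
  obtain ⟨c', hc'⟩ := X.exists_same_degree Y hI i ((e i).symm c) (fun _ => hmin _ _ _)
    (fun _ _ _ => hmin _ _ _)
  rw [hY]
  exact ⟨c', by rw [hc', hw, Equiv.apply_symm_apply]⟩

/-- A position of a graded free resolution without neighbours of the same internal degree is the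
position of a nonzero Betti number. -/
theorem MinimalGradedFreeResolution.betti_ne_zero_of_isolated {I : Ideal (MvPolynomial σ K)}
    (F : MinimalGradedFreeResolution I) (hI : ∀ f ∈ I, ∀ j, homogeneousComponent j f ∈ I)
    {S : Set (ℕ × ℕ)} (hS : HasResolution I S) {i j : ℕ} (h : (i, j) ∈ S)
    (hiso : ∀ i', (i', j) ∈ S → i' = i) : F.betti i j ≠ 0 := by
  obtain ⟨X, e, hw, -⟩ := F.exists_gradedFreeResolution
  obtain ⟨Y, hY⟩ := hS
  obtain ⟨c, rfl⟩ := (hY i j).1 h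
  -- A nonzero constant entry joins basis elements of equal degree in neighbouring homological
  -- degrees, so an isolated position has none.
  have hdeg : ∀ (i : ℕ) (c : Y.ι i) (c' : Y.ι (i + 1)),
      constantCoeff (Y.d i (Pi.single c' 1) c) ≠ 0 → Y.w i c = Y.w (i + 1) c' := by
    intro i c c' h
    have := Y.d_graded i c' c 0 h
    rwa [map_zero, zero_add] at this
  obtain ⟨c', hc'⟩ := Y.exists_same_degree X hI i c
    (fun c' => by
      by_contra hne
      have := hiso (i + 1) ((hY _ _).2 ⟨c', (hdeg i c c' hne).symm⟩)
      omega)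
    (fun i' hi c' => by
      subst hi
      by_contra hne
      have := hiso i' ((hY _ _).2 ⟨c', hdeg i' c' c hne⟩)
      omega)
  rw [F.betti_ne_zero_iff]
  exact ⟨e i c', by rw [← hw, hc']⟩

end Minimal

/-! ### Squarefree monomial ideals and their colon ideals. -/

section SquarefreeIdeals

variable {K σ : Type*} [Field K]

/-- The ideal generated by the squarefree monomials with supports in `A`. -/
noncomputable def squarefreeIdeal (K : Type*) [Field K] {σ : Type*} (A : Set (Finset σ)) :
    Ideal (MvPolynomial σ K) :=
  Ideal.span ((fun v : Finset σ => ∏ a ∈ v, X a) '' A)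

theorem prod_X_eq_monomial (v : Finset σ) :
    (∏ a ∈ v, X a : MvPolynomial σ K) = monomial (∑ a ∈ v, Finsupp.single a 1) 1 := by
  rw [monomial_sum_one]
  rfl

theorem isHomogeneous_prod_X (v : Finset σ) :
    (∏ a ∈ v, X a : MvPolynomial σ K).IsHomogeneous v.card := by
  have := IsHomogeneous.prod v (fun a => (X a : MvPolynomial σ K)) (fun _ => 1)
    fun a _ => isHomogeneous_X K a
  simpa using this

theorem sum_single_apply [DecidableEq σ] (v : Finset σ) (b : σ) :
    (∑ a ∈ v, Finsupp.single a 1 : σ →₀ ℕ) b = if b ∈ v then 1 else 0 := by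
  rw [Finsupp.finsetSum_apply]
  simp [Finsupp.single_apply]

theorem sum_single_le_iff (v : Finset σ) (u : σ →₀ ℕ) :
    (∑ a ∈ v, Finsupp.single a 1 : σ →₀ ℕ) ≤ u ↔ v ⊆ u.support := by
  classical
  constructor
  · intro h a ha
    have := h a
    rw [sum_single_apply, if_pos ha] at this
    rw [Finsupp.mem_support_iff]
    omega
  · intro h a
    rw [sum_single_apply]
    split_ifs with ha
    · have := Finsupp.mem_support_iff.1 (h ha)
      omega
    · exact Nat.zero_le _

theorem mem_squarefreeIdeal_iff (A : Set (Finset σ)) (f : MvPolynomial σ K) :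
    f ∈ squarefreeIdeal K A ↔ ∀ u ∈ f.support, ∃ v ∈ A, v ⊆ u.support := by
  have h : (fun v : Finset σ => (∏ a ∈ v, X a : MvPolynomial σ K)) '' A =
      (fun s => monomial s (1 : K)) '' ((fun v : Finset σ => ∑ a ∈ v, Finsupp.single a 1) '' A) := by
    rw [Set.image_image]
    exact Set.image_congr fun v _ => prod_X_eq_monomial v
  rw [squarefreeIdeal, h, mem_ideal_span_monomial_image]
  simp [sum_single_le_iff]

theorem homogeneousComponent_mem_squarefreeIdeal (A : Set (Finset σ)) :
    ∀ f ∈ squarefreeIdeal K A, ∀ j, homogeneousComponent j f ∈ squarefreeIdeal K A := by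
  intro f hf j
  rw [mem_squarefreeIdeal_iff] at hf ⊢
  intro u hu
  rw [mem_support_iff, coeff_homogeneousComponent] at hu
  refine hf u (mem_support_iff.2 fun h => hu ?_)
  rw [h, ite_self]

theorem constantCoeff_eq_zero_of_mem_squarefreeIdeal {A : Set (Finset σ)} (hA : ∅ ∉ A)
    {f : MvPolynomial σ K} (hf : f ∈ squarefreeIdeal K A) : constantCoeff f = 0 := by
  by_contra h
  obtain ⟨v, hv, hv0⟩ := (mem_squarefreeIdeal_iff A f).1 hf 0 (mem_support_iff.2 h)
  rw [Finsupp.support_zero, Finset.subset_empty] at hv0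
  exact hA (hv0 ▸ hv)

/-- Multiplication by the monomial of `w` enlarges the support of every exponent by `w`, and v ⊆ w ∪
supp u is the same as v \ w ⊆ supp u. -/
theorem mem_squarefreeIdeal_sdiff_iff [DecidableEq σ] (A : Set (Finset σ)) (w : Finset σ)
    (f : MvPolynomial σ K) : f ∈ squarefreeIdeal K ((fun v => v \ w) '' A) ↔
      (∏ a ∈ w, X a) * f ∈ squarefreeIdeal K A := by
  rw [prod_X_eq_monomial, mem_squarefreeIdeal_iff, mem_squarefreeIdeal_iff]
  constructor
  · intro h u hu
    rw [mem_support_iff, coeff_monomial_mul', one_mul] at hu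
    by_cases hw : ∑ a ∈ w, Finsupp.single a 1 ≤ u
    · rw [if_pos hw] at hu
      obtain ⟨_, ⟨v, hv, rfl⟩, hvu⟩ := h _ (mem_support_iff.2 hu)
      refine ⟨v, hv, fun a ha => ?_⟩
      by_cases haw : a ∈ w
      · exact (sum_single_le_iff w u).1 hw haw
      · have := Finsupp.mem_support_iff.1 (hvu (Finset.mem_sdiff.2 ⟨ha, haw⟩))
        rw [Finsupp.tsub_apply] at this
        rw [Finsupp.mem_support_iff]
        omega
    · rw [if_neg hw] at hu
      exact absurd rfl hu
  · intro h u hu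
    obtain ⟨v, hv, hvu⟩ := h ((∑ a ∈ w, Finsupp.single a 1) + u) (by
      rw [mem_support_iff, coeff_monomial_mul, one_mul]
      exact mem_support_iff.1 hu)
    refine ⟨_, ⟨v, hv, rfl⟩, fun a ha => ?_⟩
    rw [Finset.mem_sdiff] at ha
    have := Finsupp.mem_support_iff.1 (hvu ha.1)
    rw [Finsupp.add_apply, sum_single_apply, if_neg ha.2, zero_add] at this
    exact Finsupp.mem_support_iff.2 this

theorem squarefreeIdeal_le {A B : Set (Finset σ)} (h : ∀ v ∈ A, ∃ v' ∈ B, v' ⊆ v) :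
    squarefreeIdeal K A ≤ squarefreeIdeal K B := by
  intro f hf
  rw [mem_squarefreeIdeal_iff] at hf ⊢
  intro u hu
  obtain ⟨v, hv, hvu⟩ := hf u hu
  obtain ⟨v', hv', hv'v⟩ := h v hv
  exact ⟨v', hv', hv'v.trans hvu⟩

theorem squarefreeIdeal_eq_top {A : Set (Finset σ)} (h : ∅ ∈ A) : squarefreeIdeal K A = ⊤ := by
  rw [Ideal.eq_top_iff_one]
  exact Ideal.subset_span ⟨∅, h, Finset.prod_empty⟩

theorem squarefreeIdeal_empty : squarefreeIdeal K (∅ : Set (Finset σ)) = ⊥ := by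
  rw [squarefreeIdeal, Set.image_empty, Ideal.span_empty]

theorem hasResolution_insert [DecidableEq σ] {A : Set (Finset σ)} (w : Finset σ)
    {S S' : Set (ℕ × ℕ)} (hA : HasResolution (squarefreeIdeal K A) S)
    (hcolon : HasResolution (squarefreeIdeal K ((fun v => v \ w) '' A)) S') :
    HasResolution (squarefreeIdeal K (insert w A))
      (S ∪ (fun q : ℕ × ℕ => (q.1 + 1, q.2 + w.card)) '' S') := by
  have h := hasResolution_sup_span hA (homogeneousComponent_mem_squarefreeIdeal A)
    (isHomogeneous_prod_X w) hcolon (mem_squarefreeIdeal_sdiff_iff A w)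
  rwa [squarefreeIdeal, ← Ideal.span_union, Set.union_singleton,
    ← Set.image_insert_eq (f := fun v : Finset σ => (∏ a ∈ v, X a : MvPolynomial σ K))] at h

end SquarefreeIdeals

/-! ### Families of intervals on a line. -/

section Line

/-- The position `q` of a graded free resolution obeys the bounds for the family of intervals
with first interval `[x, y)` followed by the truncated windows starting in `(x, n)`, where `a` and
`b` are the numbers of multiples of `l` in `(x, n]` and `(y, n]`. -/
structure LineBound (T n x a b : ℕ) (q : ℕ × ℕ) : Prop where
  -- With the least admissible c and c' this is i ≤ ⌈a/T⌉ + ⌈b/T⌉; the quantified form avoids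
  -- ceilings.
  pd : ∀ c c', a ≤ c * T → b ≤ c' * T → q.1 ≤ c + c'
  -- Case of a and b in the same block (cT, cT + T] when b ≤ a; the bound is one better unless b is
  -- the first element of the block.
  regSame : ∀ c, c * T < b → a ≤ c * T + T → q.2 + x + 2 * c + 2 ≤ n + q.1 ∧
    (b ≠ c * T + 1 → q.2 + x + 2 * c + 3 ≤ n + q.1)
  -- Case of b below the block of a; now it is a whose being first in its block decides.
  regNext : ∀ c, c * T < a → a ≤ c * T + T → b ≤ c * T → q.2 + x + 2 * c + 1 ≤ n + q.1 ∧
    (a ≠ c * T + 1 → q.2 + x + 2 * c + 2 ≤ n + q.1)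

/-- All positions in `S` obey the bounds, and the top position occurs where it has to. -/
structure LineBounds (T n x a b : ℕ) (S : Set (ℕ × ℕ)) : Prop where
  bound : ∀ q ∈ S, LineBound T n x a b q
  topSame : ∀ c, b = c * T + 1 → a ≤ c * T + T → b < a → (2 * c + 2, n - x) ∈ S
  -- For c ≥ 1 the last hypothesis says b ≠ a - T. It excludes an interval that reaches the end of
  -- the next window and is therefore redundant.
  topNext : ∀ c, a = c * T + 1 → b ≤ c * T → b + T ≠ c * T + 1 → (2 * c + 1, n - x) ∈ S

theorem lineBounds_single {T n x y b : ℕ} (hT : 2 ≤ T) (hb : b ≤ 1) (hxy : x < y) (hyn : y ≤ n)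
    (hb0 : b = 0 ↔ y = n) : LineBounds T n x 1 b ({(0, 0)} ∪ {(1, y - x)}) where
  bound := by
    have hmul : ∀ c, c = 0 ∨ ∃ c', c = c' + 1 ∧ c * T = c' * T + T := fun c => by
      rcases c with _ | c
      · exact Or.inl rfl
      · exact Or.inr ⟨c, rfl, Nat.succ_mul c T⟩
    rintro q (rfl | rfl)
    · refine ⟨fun c c' _ _ => Nat.zero_le _, fun c h1 h2 => ?_, fun c h1 h2 h3 => ?_⟩ <;>
      · obtain rfl | ⟨c', rfl, h⟩ := hmul c
        · simp only [zero_mul] at *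
          omega
        · omega
    · refine ⟨fun c c' h1 h2 => ?_, fun c h1 h2 => ?_, fun c h1 h2 h3 => ?_⟩ <;>
      · obtain rfl | ⟨c', rfl, h⟩ := hmul c
        · simp only [zero_mul] at *
          omega
        · dsimp only
          omega
  topSame c h1 h2 h3 := by
    omega
  topNext c h1 h2 h3 := by
    rcases c with _ | c
    · rw [zero_mul] at h2
      obtain rfl := hb0.1 (by omega)
      exact Or.inr rfl
    · rw [Nat.succ_mul] at h1
      omega

/-- `S` belongs to the family without the interval and `S'` to the colon ideal. Passing to (b, a -
T) interchanges the two cases: `regSame` for c comes from `regNext` for c, and `regNext` for c from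
`regSame` for c - 1. The empty `S'` is the unit colon ideal of a redundant interval. -/
theorem lineBounds_step {T n x y x' a b : ℕ} {S S' : Set (ℕ × ℕ)} (hT : 2 ≤ T) (ha : 2 ≤ a)
    (hxy : x < y) (hyn : y ≤ n) (hba : b ≤ a) (hab : a - T ≤ b) (hx' : x < x')
    (hx'' : b = a → x + 2 ≤ x') (hS : LineBounds T n x' (a - 1) (a - T) S)
    (hS' : (1 ≤ b ∧ LineBounds T n y b (a - T) S') ∨ (S' = ∅ ∧ b = a - T)) :
    LineBounds T n x a b (S ∪ (fun q : ℕ × ℕ => (q.1 + 1, q.2 + (y - x))) '' S') where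
  bound := by
    rintro q (hq | ⟨q, hq, rfl⟩)
    · have hq := hS.bound q hq
      refine ⟨fun c c' h1 h2 => hq.pd c c' (by omega) (by omega), fun c h1 h2 => ?_,
        fun c h1 h2 h3 => ?_⟩
      · by_cases hr : a = c * T + 1
        · rcases c with _ | c
          · omega
          · simp only [add_mul, one_mul] at *
            have := hq.regSame c (by omega) (by omega)
            have := hx'' (by omega)
            omega
        · have := hq.regNext c (by omega) (by omega) (by omega)
          by_cases hr2 : a = c * T + 2
          · by_cases hb : b = a
            · have := hx'' hb
              omega
            · omega
          · have := this.2 (by omega)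
            omega
      · by_cases hr : a = c * T + 1
        · rcases c with _ | c
          · omega
          · simp only [add_mul, one_mul] at *
            have := hq.regSame c (by omega) (by omega)
            omega
        · have := hq.regNext c (by omega) (by omega) (by omega)
          omega
    · rcases hS' with ⟨hb, hS'⟩ | ⟨rfl, -⟩
      · have hq := hS'.bound q hq
        refine ⟨fun c c' h1 h2 => ?_, fun c h1 h2 => ?_, fun c h1 h2 h3 => ?_⟩
        · rcases c with _ | c
          · omega
          · rw [Nat.succ_mul] at h1
            have := hq.pd c' c h2 (by omega)
            dsimp only
            omega
        · have := hq.regNext c h1 (by omega) (by omega)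
          dsimp only
          omega
        · rcases c with _ | c
          · omega
          · simp only [add_mul, one_mul] at *
            have := hq.regSame c (by omega) (by omega)
            omega
      · exact absurd hq (Set.notMem_empty q)
  topSame c h1 h2 h3 := by
    rcases hS' with ⟨hb, hS'⟩ | ⟨rfl, hb⟩
    · refine Or.inr ⟨_, hS'.topNext c h1 (by omega) ?_, ?_⟩
      · rcases c with _ | c
        · omega
        · simp only [add_mul, one_mul] at *
          omega
      · rw [Prod.mk.injEq]
        omega
    · omega
  topNext c h1 h2 h3 := by
    rcases c with _ | c
    · omega
    · simp only [add_mul, one_mul] at *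
      rcases hS' with ⟨hb, hS'⟩ | ⟨rfl, hb⟩
      · refine Or.inr ⟨_, hS'.topSame c (by omega) (by omega) (by omega), ?_⟩
        rw [Prod.mk.injEq]
        omega
      · omega

variable {K σ : Type*} [Field K] [DecidableEq σ]

/-- The image of the interval `[x, y)`. -/
def interval (φ : ℕ → σ) (x y : ℕ) : Finset σ := (Finset.Ico x y).image φ

/-- The intervals `[z, z + m)`, cut off at `n`, for the multiples `z` of `l` with `x < z < n`. -/
def windowsAfter (φ : ℕ → σ) (l m n x : ℕ) : Set (Finset σ) :=
  {v | ∃ z, l ∣ z ∧ x < z ∧ z < n ∧ v = interval φ z (min (z + m) n)}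

theorem interval_subset {φ : ℕ → σ} {x y x' y' : ℕ} (hx : x' ≤ x) (hy : y ≤ y') :
    interval φ x y ⊆ interval φ x' y' :=
  Finset.image_subset_image (Finset.Ico_subset_Ico hx hy)

theorem card_interval {φ : ℕ → σ} {n x y : ℕ} (hφ : Set.InjOn φ (Set.Iio n)) (hy : y ≤ n) :
    (interval φ x y).card = y - x := by
  rw [interval, Finset.card_image_of_injOn, Nat.card_Ico]
  refine hφ.mono fun z hz => ?_
  have := Finset.mem_Ico.1 hz
  exact lt_of_lt_of_le this.2 hy

theorem mem_interval {φ : ℕ → σ} {n x y z : ℕ} (hφ : Set.InjOn φ (Set.Iio n)) (hy : y ≤ n)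
    (hz : z < n) : φ z ∈ interval φ x y ↔ x ≤ z ∧ z < y := by
  rw [interval, Finset.mem_image]
  constructor
  · rintro ⟨z', hz', h⟩
    rw [Finset.mem_Ico] at hz'
    rw [← hφ (show z' < n by omega) hz h]
    exact hz'
  · intro h
    exact ⟨z, Finset.mem_Ico.2 h, rfl⟩

/-- For `x ≤ z ≤ y`, removing `[x, y)` from `[z, w)` leaves `[y, w)`. -/
theorem interval_sdiff {φ : ℕ → σ} {n x y z w : ℕ} (hφ : Set.InjOn φ (Set.Iio n)) (hy : y ≤ n)
    (hw : w ≤ n) (hxz : x ≤ z) (hzy : z ≤ y) :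
    interval φ z w \ interval φ x y = interval φ y w := by
  ext b
  rw [Finset.mem_sdiff]
  constructor
  · rintro ⟨h1, h2⟩
    obtain ⟨b, hb, rfl⟩ := Finset.mem_image.1 h1
    rw [Finset.mem_Ico] at hb
    rw [mem_interval hφ hy (by omega)] at h2
    rw [mem_interval hφ hw (by omega)]
    omega
  · intro h
    obtain ⟨b, hb, rfl⟩ := Finset.mem_image.1 h
    rw [Finset.mem_Ico] at hb
    rw [mem_interval hφ hy (by omega), mem_interval hφ hw (by omega)]
    omega

theorem interval_sdiff_of_le {φ : ℕ → σ} {n x y z w : ℕ} (hφ : Set.InjOn φ (Set.Iio n))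
    (hw : w ≤ n) (hyz : y ≤ z) : interval φ z w \ interval φ x y = interval φ z w := by
  rcases lt_or_ge n y with hy | hy
  · rw [interval, Finset.Ico_eq_empty (by omega), Finset.image_empty, Finset.empty_sdiff]
  rw [Finset.sdiff_eq_self_iff_disjoint, Finset.disjoint_left]
  intro b h1 h2
  obtain ⟨b, hb, rfl⟩ := Finset.mem_image.1 h1
  rw [Finset.mem_Ico] at hb
  rw [mem_interval hφ hy (by omega)] at h2
  omega

/-- Induction on a bound `N` for n - x, since both families of the recursion start further right.
The bound on `y` keeps [x, y) from passing the end of the next window, and both families inherit it.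
-/
theorem exists_line_resolution (K : Type*) [Field K] {φ : ℕ → σ} {k l m n t s : ℕ}
    (hφ : Set.InjOn φ (Set.Iio n)) (hl : 1 ≤ l) (hn : n = k * l) (hm : m = t * l + s)
    (hs : s < l) (ht : 1 ≤ t) (N x y : ℕ) (hN : n ≤ x + N) (hxy : x < y)
    (hy : y ≤ min ((x / l + 1) * l + m) n) :
    ∃ S, HasResolution (squarefreeIdeal K (insert (interval φ x y) (windowsAfter φ l m n x))) S ∧
      LineBounds (t + 1) n x (k - x / l) (k - y / l) S := by
  induction N generalizing x y with
  | zero => omega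
  | succ N ih =>
    have hxn : x < n := by omega
    have hyn : y ≤ n := by omega
    have hnl : n / l = k := by rw [hn]; exact Nat.mul_div_cancel _ hl
    have hmodx : ∀ z, z < (z / l + 1) * l := fun z => by
      rw [mul_comm]; exact Nat.lt_mul_div_succ z hl
    have hdivx : ∀ z, z / l * l ≤ z := fun z => Nat.div_mul_le_self z l
    obtain ⟨ξ, hξ⟩ : ∃ ξ, ξ = x / l := ⟨_, rfl⟩
    obtain ⟨x', hx'⟩ : ∃ x', x' = (ξ + 1) * l := ⟨_, rfl⟩
    have hxx' : x < x' := by rw [hx', hξ]; exact hmodx x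
    have hx'l : x' / l = ξ + 1 := by rw [hx']; exact Nat.mul_div_cancel _ hl
    have hnext : ∀ z, l ∣ z → x < z → x' ≤ z := by
      rintro z ⟨z, rfl⟩ hz
      rw [hx', mul_comm l z]
      refine Nat.mul_le_mul_right l ?_
      rw [hξ, Nat.succ_le_iff, Nat.div_lt_iff_lt_mul hl]
      rwa [mul_comm]
    have hyl : x / l ≤ y / l := Nat.div_le_div_right hxy.le
    have hyk : y / l ≤ k := by rw [← hnl]; exact Nat.div_le_div_right hyn
    have hykn : y / l = k ↔ y = n := by
      constructor
      · intro h
        have := hdivx y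
        rw [h, ← hn] at this
        omega
      · rintro rfl
        exact hnl
    have hxk : x / l < k := by
      rw [Nat.div_lt_iff_lt_mul hl, ← hn]
      exact hxn
    rw [← hξ] at hy hyl hxk ⊢
    rcases Nat.lt_or_ge x' n with hx'n | hx'n
    · obtain ⟨y', hy'⟩ : ∃ y', y' = min (x' + m) n := ⟨_, rfl⟩
      have hy'l : y' / l = min (ξ + 1 + t) k := by
        have h1 : (x' + m) / l = ξ + 1 + t := by
          rw [hx', hm, ← add_assoc, ← add_mul, mul_comm _ l, Nat.mul_add_div hl,
            Nat.div_eq_of_lt hs, add_zero]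
        rw [hy', ← h1, ← hnl]
        rcases le_total (x' + m) n with h | h
        · rw [min_eq_left h, min_eq_left (Nat.div_le_div_right h)]
        · rw [min_eq_right h, min_eq_right (Nat.div_le_div_right h)]
      rw [← hx', ← hy'] at hy
      have hlm : l ≤ m := by nlinarith
      have hx'k : ξ + 1 < k := by
        rw [hx', hn] at hx'n
        exact lt_of_mul_lt_mul_right hx'n (Nat.zero_le l)
      have hyy' : y / l ≤ y' / l := Nat.div_le_div_right hy
      have hset : windowsAfter φ l m n x =
          insert (interval φ x' y') (windowsAfter φ l m n x') := by
        ext v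
        rw [Set.mem_insert_iff]
        constructor
        · rintro ⟨z, hz, hxz, hzn, rfl⟩
          rcases (hnext z hz hxz).eq_or_lt with rfl | h
          · exact Or.inl (by rw [hy'])
          · exact Or.inr ⟨z, hz, h, hzn, rfl⟩
        · rintro (rfl | ⟨z, hz, hxz, hzn, rfl⟩)
          · exact ⟨x', ⟨ξ + 1, by rw [hx', mul_comm]⟩, hxx', hx'n, by rw [hy']⟩
          · exact ⟨z, hz, hxx'.trans hxz, hzn, rfl⟩
      obtain ⟨S, hS, hSb⟩ := ih x' y' (by omega) (by omega) (by
        have : x' ≤ (x' / l + 1) * l := (hmodx x').le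
        omega)
      rw [← hset] at hS
      have hmono : ∀ z, l ∣ z → x < z → y' ≤ min (z + m) n := fun z hz hxz => by
        have := hnext z hz hxz
        omega
      obtain ⟨S', hS', hSb'⟩ : ∃ S', HasResolution (squarefreeIdeal K
          ((fun v => v \ interval φ x y) '' windowsAfter φ l m n x)) S' ∧
          ((1 ≤ k - y / l ∧ LineBounds (t + 1) n y (k - y / l) (k - ξ - (t + 1)) S') ∨
            (S' = ∅ ∧ k - y / l = k - ξ - (t + 1))) := by
        -- If y = y', the next window lies in [x, y) and the colon ideal is the whole ring.
        rcases hy.eq_or_lt with hyy | hyy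
        · refine ⟨∅, ?_, Or.inr ⟨rfl, by rw [hyy, hy'l]; omega⟩⟩
          rw [squarefreeIdeal_eq_top]
          · exact hasResolution_top
          · refine ⟨interval φ x' y', ?_, ?_⟩
            · rw [hset]
              exact Set.mem_insert _ _
            · rw [Finset.sdiff_eq_empty_iff_subset]
              exact interval_subset hxx'.le hyy.ge
        · have hyk' : y / l < k := by
            refine lt_of_le_of_ne hyk fun h => ?_
            have := hykn.1 h
            omega
          obtain ⟨S', hS', hSb'⟩ := ih y y' (by omega) hyy (by
            have : x' ≤ (y / l + 1) * l := by
              rw [hx']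
              exact Nat.mul_le_mul_right l (by omega)
            omega)
          refine ⟨S', ?_, Or.inl ⟨by omega, ?_⟩⟩
          · convert hS' using 1
            apply le_antisymm
            · refine squarefreeIdeal_le ?_
              rintro _ ⟨_, ⟨z, hz, hxz, hzn, rfl⟩, rfl⟩
              rcases le_or_gt z y with hzy | hzy
              · refine ⟨_, Set.mem_insert _ _, ?_⟩
                dsimp only
                rw [interval_sdiff hφ hyn (min_le_right _ _) hxz.le hzy]
                exact interval_subset le_rfl (hmono z hz hxz)
              · refine ⟨_, Set.mem_insert_of_mem _ ⟨z, hz, hzy, hzn, rfl⟩, ?_⟩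
                dsimp only
                rw [interval_sdiff_of_le hφ (min_le_right _ _) hzy.le]
            · refine squarefreeIdeal_le ?_
              rintro _ (rfl | ⟨z, hz, hyz, hzn, rfl⟩)
              · refine ⟨_, ⟨interval φ x' y', ?_, rfl⟩, ?_⟩
                · rw [hset]
                  exact Set.mem_insert _ _
                · dsimp only
                  -- If y ≤ x', the interval [y, y') contains [x', y'); adjoining it leaves the
                  -- ideal unchanged and keeps the family in the class.
                  rcases le_total x' y with h | h
                  · rw [interval_sdiff hφ hyn (by omega) hxx'.le h]
                  · rw [interval_sdiff_of_le hφ (by omega) h]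
                    exact interval_subset h le_rfl
              · exact ⟨_, ⟨_, ⟨z, hz, hxy.trans hyz, hzn, rfl⟩, rfl⟩, Finset.sdiff_subset⟩
          · have h : k - ξ - (t + 1) = k - y' / l := by rw [hy'l]; omega
            rw [h]
            exact hSb'
      refine ⟨_, hasResolution_insert _ hS hS', ?_⟩
      rw [card_interval hφ hyn]
      rw [hx'l, hy'l] at hSb
      refine lineBounds_step (x' := x') (by omega) (by omega) hxy hyn (by omega) ?_ hxx' ?_ ?_ hSb'
      · rw [hy'l] at hyy'
        omega
      · intro h
        have h1 : y / l = ξ := by omega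
        have h2 := hmodx y
        rw [h1, ← hx'] at h2
        omega
      · have h1 : k - ξ - 1 = k - (ξ + 1) := by omega
        have h2 : k - ξ - (t + 1) = k - min (ξ + 1 + t) k := by omega
        rw [h1, h2]
        exact hSb
    · have hk : k = ξ + 1 := by
        rw [hx', hn] at hx'n
        have := le_of_mul_le_mul_right hx'n hl
        omega
      have hempty : windowsAfter φ l m n x = ∅ := by
        rw [Set.eq_empty_iff_forall_notMem]
        rintro v ⟨z, hz, hxz, hzn, -⟩
        have := hnext z hz hxz
        omega
      have hS : HasResolution (squarefreeIdeal K (∅ : Set (Finset σ))) {(0, 0)} := by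
        rw [squarefreeIdeal_empty]
        exact hasResolution_bot
      have h := hasResolution_insert (interval φ x y) hS (by rw [Set.image_empty]; exact hS)
      rw [hempty]
      refine ⟨_, h, ?_⟩
      rw [Set.image_singleton, card_interval hφ hyn, zero_add, zero_add]
      have h1 : k - ξ = 1 := by omega
      rw [h1]
      exact lineBounds_single (by omega) (by omega) hxy hyn (by omega)

end Line

/-! ### From the line to the cycle. -/

section Cycle

/-- The support `{x_{jl+1}, …, x_{jl+m}}` of a generator of the path ideal of the `n`-cycle. -/
def cycleWindow (l m n j : ℕ) : Finset (ZMod n) :=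
  (Finset.Icc 1 m).image fun i => ((j * l + i : ℕ) : ZMod n)

/-- The variables of the `n`-cycle, counted from the first vertex of the `r`-th window. -/
def cycleCoord (l n r i : ℕ) : ZMod n := ((r * l + 1 + i : ℕ) : ZMod n)

theorem injOn_cycleCoord (l n r : ℕ) : Set.InjOn (cycleCoord l n r) (Set.Iio n) := by
  intro i hi j hj h
  have h1 := (ZMod.natCast_eq_natCast_iff _ _ _).1 h
  have h2 : i ≡ j [MOD n] := Nat.ModEq.add_left_cancel' _ h1
  rwa [Nat.ModEq, Nat.mod_eq_of_lt hi, Nat.mod_eq_of_lt hj] at h2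

theorem cycleWindow_self (l m n r : ℕ) :
    cycleWindow l m n r = interval (cycleCoord l n r) 0 m := by
  ext b
  simp only [cycleWindow, interval, cycleCoord, Finset.mem_image, Finset.mem_Icc, Finset.mem_Ico]
  constructor
  · rintro ⟨i, hi, rfl⟩
    exact ⟨i - 1, by omega, by congr 1; omega⟩
  · rintro ⟨i, hi, rfl⟩
    exact ⟨i + 1, by omega, by congr 1; omega⟩

/-- Window j starts (j - r)l steps after window r; adding n = kl keeps this a natural number. The
interval may run past n and wrap around. -/
theorem cycleWindow_eq_interval {k l m n r : ℕ} (hn : n = k * l) (hr : r ≤ k) (j : ℕ) :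
    cycleWindow l m n j = interval (cycleCoord l n r) ((k - r + j) * l) ((k - r + j) * l + m) := by
  have h : ∀ i, cycleCoord l n r ((k - r + j) * l + i) = ((j * l + (i + 1) : ℕ) : ZMod n) := by
    intro i
    have h1 : r * l + 1 + ((k - r + j) * l + i) = n + (j * l + (i + 1)) := by
      obtain ⟨e, rfl⟩ := Nat.exists_eq_add_of_le hr
      rw [hn, Nat.add_sub_cancel_left]
      ring
    rw [cycleCoord, h1, Nat.cast_add, ZMod.natCast_self, zero_add]
  ext b
  simp only [cycleWindow, interval, Finset.mem_image, Finset.mem_Icc, Finset.mem_Ico]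
  constructor
  · rintro ⟨i, hi, rfl⟩
    refine ⟨(k - r + j) * l + (i - 1), by omega, ?_⟩
    rw [h, Nat.sub_add_cancel hi.1]
  · rintro ⟨i, hi, rfl⟩
    obtain ⟨i', rfl⟩ := Nat.exists_eq_add_of_le hi.1
    exact ⟨i' + 1, by omega, (h i').symm⟩

/-- Let z < n be the start of window j. What it has beyond n wraps around into [0, m), which is
window r and is removed. -/
theorem cycleWindow_sdiff {k l m n r j : ℕ} (hn : n = k * l) (hmn : m ≤ n) (hl : 1 ≤ l)
    (hr : r ≤ k) (hj : j < r) :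
    cycleWindow l m n j \ cycleWindow l m n r = interval (cycleCoord l n r)
      (max ((k - r + j) * l) m) (min ((k - r + j) * l + m) n) := by
  have hz : (k - r + j) * l < n := by
    rw [hn]
    exact Nat.mul_lt_mul_of_pos_right (by omega) hl
  rw [cycleWindow_self l m n r, cycleWindow_eq_interval hn hr j]
  generalize (k - r + j) * l = z at hz
  have hinj := injOn_cycleCoord l n r
  ext b
  rw [Finset.mem_sdiff]
  constructor
  · rintro ⟨h1, h2⟩
    obtain ⟨i, hi, rfl⟩ := Finset.mem_image.1 h1
    rw [Finset.mem_Ico] at hi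
    rcases lt_or_ge i n with hin | hin
    · rw [mem_interval hinj hmn hin] at h2
      rw [mem_interval hinj (min_le_right _ _) hin]
      omega
    · have h3 : cycleCoord l n r i = cycleCoord l n r (i - n) := by
        have h4 : r * l + 1 + i = n + (r * l + 1 + (i - n)) := by omega
        rw [cycleCoord, h4, Nat.cast_add, ZMod.natCast_self, zero_add, cycleCoord]
      rw [h3, mem_interval hinj hmn (by omega)] at h2
      omega
  · intro h
    obtain ⟨i, hi, rfl⟩ := Finset.mem_image.1 h
    rw [Finset.mem_Ico] at hi
    rw [mem_interval hinj hmn (by omega)]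
    exact ⟨Finset.mem_image.2 ⟨i, Finset.mem_Ico.2 (by omega), rfl⟩, by omega⟩

/-- The first `r` windows of the cycle. -/
def cycleWindows (l m n r : ℕ) : Set (Finset (ZMod n)) := {v | ∃ j < r, v = cycleWindow l m n j}

theorem cycleWindows_succ (l m n r : ℕ) :
    cycleWindows l m n (r + 1) = insert (cycleWindow l m n r) (cycleWindows l m n r) := by
  ext v
  rw [Set.mem_insert_iff]
  constructor
  · rintro ⟨j, hj, rfl⟩
    rcases Nat.lt_succ_iff_lt_or_eq.1 hj with h | rfl
    · exact Or.inr ⟨j, h, rfl⟩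
    · exact Or.inl rfl
  · rintro (rfl | ⟨j, hj, rfl⟩)
    · exact ⟨r, Nat.lt_succ_self r, rfl⟩
    · exact ⟨j, hj.trans (Nat.lt_succ_self r), rfl⟩

theorem cycleWindows_zero (l m n : ℕ) : cycleWindows l m n 0 = ∅ := by
  rw [Set.eq_empty_iff_forall_notMem]
  rintro v ⟨j, hj, -⟩
  omega

/-- The colon ideal of the first `r` windows by the next one belongs to a family of intervals. -/
theorem squarefreeIdeal_cycleWindows_sdiff (K : Type*) [Field K] {k l m n r : ℕ} (hn : n = k * l)
    (hmn : m ≤ n) (hl : 1 ≤ l) (hr : r < k) (hr0 : 1 ≤ r) :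
    squarefreeIdeal K ((fun v => v \ cycleWindow l m n r) '' cycleWindows l m n r) =
      squarefreeIdeal K (insert (interval (cycleCoord l n r) (max ((k - r) * l) m)
        (min ((k - r) * l + m) n))
          (windowsAfter (cycleCoord l n r) l m n (max ((k - r) * l) m))) := by
  apply le_antisymm
  · refine squarefreeIdeal_le ?_
    rintro _ ⟨_, ⟨j, hj, rfl⟩, rfl⟩
    dsimp only
    rw [cycleWindow_sdiff hn hmn hl hr.le hj]
    have hz : (k - r) * l ≤ (k - r + j) * l := Nat.mul_le_mul_right l (by omega)
    have hzn : (k - r + j) * l < n := by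
      rw [hn]
      exact Nat.mul_lt_mul_of_pos_right (by omega) hl
    by_cases h : (k - r + j) * l ≤ max ((k - r) * l) m
    · exact ⟨_, Set.mem_insert _ _, interval_subset (by omega) (by omega)⟩
    · refine ⟨_, Set.mem_insert_of_mem _ ⟨(k - r + j) * l, Dvd.intro_left _ rfl, by omega, hzn,
        rfl⟩, interval_subset (by omega) le_rfl⟩
  · refine squarefreeIdeal_le ?_
    rintro _ (rfl | ⟨_, ⟨z, rfl⟩, hxz, hzn, rfl⟩)
    · refine ⟨_, ⟨_, ⟨0, hr0, rfl⟩, rfl⟩, ?_⟩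
      dsimp only
      rw [cycleWindow_sdiff hn hmn hl hr.le hr0, add_zero]
    · have h1 : k - r < z := by
        have : (k - r) * l < z * l := by rw [mul_comm z]; omega
        exact lt_of_mul_lt_mul_right this (Nat.zero_le l)
      have h2 : z < k := by
        have : z * l < k * l := by rw [mul_comm z, ← hn]; exact hzn
        exact lt_of_mul_lt_mul_right this (Nat.zero_le l)
      refine ⟨_, ⟨_, ⟨z - (k - r), by omega, rfl⟩, rfl⟩, ?_⟩
      dsimp only
      rw [cycleWindow_sdiff hn hmn hl hr.le (by omega), Nat.add_sub_cancel' h1.le, mul_comm z]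
      exact interval_subset (by omega) le_rfl

/-- The arithmetic that turns the bounds for lines into those for cycles. -/
theorem LineBound.cycle_bound {k l m n t s p d e P : ℕ} {q : ℕ × ℕ} (hl : 1 ≤ l)
    (hm : m = t * l + s) (hs : s < l) (ht : 1 ≤ t)
    (hk : k = p * (t + 1) + (t + 1) + d) (hd : d ≤ t)
    (hP : P = if d = 0 then 2 * (p + 1) else 2 * (p + 1) + 1) (he : 1 ≤ e) (hek : e < k)
    (hq : LineBound (t + 1) n (max (e * l) m) (k - max e t) (k - min (e + t) k) q) :
    q.1 + 1 ≤ P ∧ q.2 + m + P ≤ n + q.1 + 1 := by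
  obtain ⟨T, hT⟩ : ∃ T, T = t + 1 := ⟨_, rfl⟩
  rw [← hT] at hq hk
  have hpd := hq.pd (p + 1)
  simp only [add_mul, one_mul] at hpd
  -- Here k = (p + 1)T + d. For e ≤ t the line starts at x = m with a = pT + 1 + d, and b lies in
  -- the same block as a exactly when e ≤ d.
  rcases le_or_gt e t with het | het
  · have hx : max (e * l) m = m := by
      have := Nat.mul_le_mul_right l het
      omega
    rw [hx] at hq
    rcases le_or_gt e d with hed | hed
    · have h1 := hpd (p + 1) (by omega) (by simp only [add_mul, one_mul]; omega)
      have h2 := hq.regSame p (by omega) (by omega)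
      rw [if_neg (by omega)] at hP
      omega
    · have h1 := hpd p (by omega) (by omega)
      have h2 := hq.regNext p (by omega) (by omega) (by omega)
      by_cases hd0 : d = 0
      · rw [if_pos hd0] at hP
        omega
      · rw [if_neg hd0] at hP
        have := h2.2 (by omega)
        omega
  · obtain ⟨f, rfl⟩ : ∃ f, e = T + f := ⟨e - T, by omega⟩
    have hml : m < T * l := by rw [hm, hT, add_mul, one_mul]; omega
    have hfl : f ≤ f * l := Nat.le_mul_of_pos_right f hl
    have hx : max ((T + f) * l) m = T * l + f * l := by rw [add_mul]; omega
    rw [hx] at hq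
    have h1 := hpd p (by omega) (by omega)
    obtain ⟨a, ha⟩ : ∃ a, a + 1 = k - max (T + f) t := ⟨k - max (T + f) t - 1, by omega⟩
    obtain ⟨c, hc⟩ : ∃ c, c = a / T := ⟨_, rfl⟩
    obtain ⟨r, hr⟩ : ∃ r, r = a % T := ⟨_, rfl⟩
    have har : a = c * T + r := by
      rw [hc, hr, mul_comm]
      exact (Nat.div_add_mod a T).symm
    have hrT : r < T := by
      rw [hr]
      exact Nat.mod_lt _ (by omega)
    have hcp : c ≤ p := by
      by_contra h
      have := Nat.mul_le_mul_right T (show p + 1 ≤ c by omega)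
      rw [add_mul, one_mul] at this
      omega
    obtain ⟨δ, rfl⟩ := Nat.exists_eq_add_of_le hcp
    -- Lying δ blocks below block p costs 2δ in the bound, but by `hsum` it forces f, and with it x,
    -- to grow by δT; T ≥ 2 makes up for the cost.
    have hδ : δ = 0 ∨ 2 * δ + T ≤ δ * T + 2 := by
      rcases δ with _ | δ
      · exact Or.inl rfl
      · right
        have := Nat.mul_le_mul_left δ (show 2 ≤ T by omega)
        rw [add_mul, one_mul]
        omega
    have hsum : c * T + r + 1 + f = c * T + δ * T + d := by
      rw [add_mul] at hk
      omega
    have hP' : 2 * (c + δ + 1) ≤ P ∧ P ≤ 2 * (c + δ + 1) + 1 ∧ (d = 0 → P = 2 * (c + δ + 1)) := by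
      rw [hP]
      split_ifs <;> omega
    have hψ : q.2 + T * l + f * l + 2 * c + 1 ≤ n + q.1 ∧
        (r ≠ 0 → q.2 + T * l + f * l + 2 * c + 2 ≤ n + q.1) := by
      rw [← ha] at hq
      rcases Nat.lt_or_ge (r + 1) T with hrT' | hrT'
      · have h := hq.regNext c (by omega) (by omega) (by omega)
        exact ⟨by omega, fun hr0 => by have := h.2 (by omega); omega⟩
      · have h := hq.regSame c (by omega) (by omega)
        exact ⟨by omega, fun _ => by omega⟩
    refine ⟨by omega, ?_⟩
    rcases hδ with rfl | hδ
    · rw [zero_mul] at hsum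
      by_cases hr0 : r = 0
      · omega
      · have := hψ.2 hr0
        omega
    · by_cases hr0 : r = 0
      · by_cases hd0 : d = 0
        · have := hP'.2.2 hd0
          omega
        · omega
      · have := hψ.2 hr0
        by_cases hd0 : d = 0
        · have := hP'.2.2 hd0
          omega
        · omega

/-- A graded free resolution for the first `r` windows of the cycle, within the bounds for the
cycle, and with the top position if `r` is large. -/
theorem exists_cycle_resolution (K : Type*) [Field K] {k l m n t s p d P : ℕ} (hl : 1 ≤ l)
    (hn : n = k * l) (hmn : m ≤ n) (hm : m = t * l + s) (hs : s < l) (ht : 1 ≤ t) (hk2 : 2 ≤ k)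
    (hk : k = p * (t + 1) + d) (hd : d ≤ t) (hP : P = if d = 0 then 2 * p else 2 * p + 1)
    (r : ℕ) (hr : r ≤ k) :
    ∃ S, HasResolution (squarefreeIdeal K (cycleWindows l m n r)) S ∧
      (∀ q ∈ S, q.1 ≤ P ∧ q.2 + P ≤ n + q.1) ∧
      ((if d = 0 then k - 1 else k - d) < r → (P, n) ∈ S) := by
  have hnl : ∀ z, z * l / l = z := fun z => Nat.mul_div_cancel z hl
  have hml : m / l = t := by
    rw [hm, mul_comm, Nat.mul_add_div hl, Nat.div_eq_of_lt hs, add_zero]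
  have hmT : m < (t + 1) * l := by rw [hm, add_mul, one_mul]; omega
  -- If p = 0, then k = d ≤ t and n = kl ≤ tl ≤ m, so every window is the whole cycle.
  have hp0 : p = 0 → m = n ∧ d ≠ 0 := by
    rintro rfl
    rw [zero_mul, zero_add] at hk
    have := Nat.mul_le_mul_right l hd
    rw [← hk, ← hn] at this
    omega
  have hpos : 1 ≤ P ∧ m + P ≤ n + 1 := by
    rcases p with _ | p
    · obtain ⟨h1, h2⟩ := hp0 rfl
      rw [if_neg h2] at hP
      omega
    · have h1 : n = (p * (t + 1) + d) * l + (t + 1) * l := by rw [hn, hk]; ring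
      have h2 : p * (t + 1) + d ≤ (p * (t + 1) + d) * l := Nat.le_mul_of_pos_right _ hl
      have h3 := Nat.mul_le_mul_left p (show 2 ≤ t + 1 by omega)
      split_ifs at hP <;> omega
  have hbot : HasResolution (squarefreeIdeal K (∅ : Set (Finset (ZMod n)))) {(0, 0)} := by
    rw [squarefreeIdeal_empty]
    exact hasResolution_bot
  have hcard : ∀ r, (cycleWindow l m n r).card = m := fun r => by
    rw [cycleWindow_self, card_interval (injOn_cycleCoord l n r) hmn, Nat.sub_zero]
  have htl : l ≤ t * l := Nat.le_mul_of_pos_left l ht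
  induction r with
  | zero =>
    refine ⟨{(0, 0)}, ?_, ?_, fun h => by omega⟩
    · rw [cycleWindows_zero]
      exact hbot
    · rintro _ rfl
      dsimp only
      omega
  | succ r ih =>
    obtain ⟨S, hS, hb, htop⟩ := ih (by omega)
    obtain ⟨S', hS', hb', htop'⟩ : ∃ S', HasResolution (squarefreeIdeal K
        ((fun v => v \ cycleWindow l m n r) '' cycleWindows l m n r)) S' ∧
        (∀ q ∈ S', q.1 + 1 ≤ P ∧ q.2 + m + P ≤ n + q.1 + 1) ∧
        (r = (if d = 0 then k - 1 else k - d) → (P - 1, n - m) ∈ S') := by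
      rcases Nat.eq_zero_or_pos r with rfl | hr0
      · refine ⟨{(0, 0)}, ?_, ?_, fun h => ?_⟩
        · rw [cycleWindows_zero, Set.image_empty]
          exact hbot
        · rintro _ rfl
          dsimp only
          omega
        · have hp : p = 0 := by
            by_contra hp
            have : t + 1 ≤ p * (t + 1) := Nat.le_mul_of_pos_left _ (by omega)
            split_ifs at h <;> omega
          obtain ⟨h1, h2⟩ := hp0 hp
          rw [if_neg h2, hp] at hP
          simp [hP, h1]
      · rcases hmn.eq_or_lt with hmn' | hmn'
        · refine ⟨∅, ?_, fun q hq => absurd hq (Set.notMem_empty q), fun h => ?_⟩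
          · rw [squarefreeIdeal_eq_top]
            · exact hasResolution_top
            · refine ⟨_, ⟨0, hr0, rfl⟩, ?_⟩
              dsimp only
              rw [cycleWindow_sdiff hn hmn hl (by omega) hr0, hmn', interval,
                Finset.Ico_eq_empty (by omega), Finset.image_empty]
          · exfalso
            have h1 : k < t + 1 := by
              rw [hmn', hn] at hmT
              exact lt_of_mul_lt_mul_right hmT (Nat.zero_le l)
            have hp : p = 0 := by
              by_contra hp
              have : t + 1 ≤ p * (t + 1) := Nat.le_mul_of_pos_left _ (by omega)
              omega
            rw [if_neg (hp0 hp).2] at h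
            rw [hp, zero_mul] at hk
            omega
        · have hp : p ≠ 0 := fun hp => by
            have := (hp0 hp).1
            omega
          obtain ⟨p, rfl⟩ := Nat.exists_eq_succ_of_ne_zero hp
          rw [Nat.succ_eq_add_one, add_mul, one_mul] at hk
          obtain ⟨e, he⟩ : ∃ e, e = k - r := ⟨_, rfl⟩
          have hel : l ≤ e * l := Nat.le_mul_of_pos_left l (by omega)
          have hekl : e * l + l ≤ n := by
            have := Nat.mul_le_mul_right l (show e + 1 ≤ k by omega)
            rw [hn]
            linarith
          have hxdiv : max (e * l) m / l = max e t := by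
            rcases le_total (e * l) m with h | h
            · have := Nat.div_le_div_right (c := l) h
              rw [hnl, hml] at this
              rw [max_eq_right h, hml]
              omega
            · have := Nat.div_le_div_right (c := l) h
              rw [hnl, hml] at this
              rw [max_eq_left h, hnl]
              omega
          have hydiv : min (e * l + m) n / l = min (e + t) k := by
            have h1 : (e * l + m) / l = e + t := by
              rw [mul_comm, Nat.mul_add_div hl, hml]
            have h2 : n / l = k := by rw [hn, hnl]
            rcases le_total (e * l + m) n with h | h
            · rw [min_eq_left h, h1]
              have := Nat.div_le_div_right (c := l) h
              omega
            · rw [min_eq_right h, h2]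
              have := Nat.div_le_div_right (c := l) h
              omega
          obtain ⟨S', hS', hSb⟩ := exists_line_resolution K (injOn_cycleCoord l n r) hl hn hm hs ht
            n (max (e * l) m) (min (e * l + m) n) (by omega) (by omega) (by
              have h1 : e * l ≤ (max (e * l) m / l + 1) * l := by
                rw [hxdiv]
                exact Nat.mul_le_mul_right l (by omega)
              omega)
          rw [hxdiv, hydiv] at hSb
          refine ⟨S', ?_, fun q hq => (hSb.bound q hq).cycle_bound hl hm hs ht hk hd hP (by omega)
            (by omega), fun h => ?_⟩
          · rw [squarefreeIdeal_cycleWindows_sdiff K hn hmn hl (by omega) hr0, ← he]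
            exact hS'
          · have het : e ≤ t := by split_ifs at h <;> omega
            have hx : max (e * l) m = m := by
              have := Nat.mul_le_mul_right l het
              omega
            rw [hx] at hSb
            -- The critical windows are e = 1 for d = 0, where a = pT + 1, and e = d otherwise,
            -- where b = pT + 1: these are the extremal cases in which the line has a top position.
            -- The shift by (1, m) moves it to (P, n).
            by_cases hd0 : d = 0
            · rw [if_pos hd0] at h hP
              have h1 := hSb.topNext p (by omega) (by omega) (by omega)
              rw [hP]
              exact h1
            · rw [if_neg hd0] at h hP
              have h1 := hSb.topSame p (by omega) (by omega) (by omega)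
              rw [hP]
              exact h1
    have h := hasResolution_insert _ hS hS'
    rw [← cycleWindows_succ, hcard] at h
    refine ⟨_, h, ?_, fun hlt => ?_⟩
    · rintro _ (hq | ⟨q, hq, rfl⟩)
      · exact hb _ hq
      · have := hb' q hq
        dsimp only
        omega
    · rcases Nat.lt_succ_iff_lt_or_eq.1 hlt with h1 | h1
      · exact Or.inl (htop h1)
      · refine Or.inr ⟨_, htop' h1.symm, ?_⟩
        rw [Prod.mk.injEq]
        omega

theorem pathIdeal_eq_squarefreeIdeal (K : Type*) [Field K] {l m n : ℕ} (hln : l ∣ n)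
    (hmn : m ≤ n) : pathIdeal K m l n = squarefreeIdeal K (cycleWindows l m n (n / l)) := by
  rw [pathIdeal, squarefreeIdeal, Nat.gcd_eq_left hln]
  have hprod : ∀ j, (∏ a ∈ cycleWindow l m n j, X a : MvPolynomial (ZMod n) K) =
      ∏ i ∈ Finset.Icc 1 m, X ((j * l + i : ℕ) : ZMod n) := by
    intro j
    rw [cycleWindow, Finset.prod_image]
    intro x hx y hy h
    rw [Finset.coe_Icc, Set.mem_Icc] at hx hy
    have h1 : x - 1 = y - 1 := injOn_cycleCoord l n j (show x - 1 < n by omega)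
      (show y - 1 < n by omega) (by
        have hx' : j * l + 1 + (x - 1) = j * l + x := by omega
        have hy' : j * l + 1 + (y - 1) = j * l + y := by omega
        rw [cycleCoord, cycleCoord, hx', hy']
        exact h)
    omega
  congr 1
  ext f
  constructor
  · rintro ⟨i, rfl⟩
    exact ⟨_, ⟨i, i.2, rfl⟩, hprod i⟩
  · rintro ⟨_, ⟨j, hj, rfl⟩, rfl⟩
    exact ⟨⟨j, hj⟩, (hprod j).symm⟩

theorem corollary5p4 {K : Type*} [Field K] (m l n t s k p d : ℕ)
    (hm : 2 ≤ m) (hmn : m ≤ n) (hl : 1 ≤ l) (hln : l ∣ n) (hlm : l ≤ m - 1) (hl2 : 2 * l ≤ n)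
    (hmts : m = t * l + s) (hs : s < l) (hk : k = n / l)
    (hkpd : k = p * (t + 1) + d) (hd : d ≤ t) :
    Nonempty (MinimalGradedFreeResolution (pathIdeal K m l n)) ∧
    ∀ F : MinimalGradedFreeResolution (pathIdeal K m l n),
      IsGreatest {i : ℕ | ∃ j : ℕ, F.betti i j ≠ 0} (if d = 0 then 2 * p else 2 * p + 1) ∧
      IsGreatest {r : ℤ | ∃ i j : ℕ, F.betti i j ≠ 0 ∧ r = (j : ℤ) - (i : ℤ)}
        (if d = 0 then (n : ℤ) - 2 * (p : ℤ) else (n : ℤ) - 2 * (p : ℤ) - 1) := by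
  have hn : n = k * l := by rw [hk, Nat.div_mul_cancel hln]
  have hk2 : 2 ≤ k := by rw [hk]; exact (Nat.le_div_iff_mul_le hl).2 hl2
  have ht : 1 ≤ t := by
    by_contra h
    obtain rfl : t = 0 := by omega
    omega
  have : NeZero n := ⟨by omega⟩
  obtain ⟨P, hP⟩ : ∃ P, P = if d = 0 then 2 * p else 2 * p + 1 := ⟨_, rfl⟩
  obtain ⟨S, hS, hb, htop⟩ :=
    exists_cycle_resolution K hl hn hmn hmts hs ht hk2 hkpd hd hP k le_rfl
  have htop : (P, n) ∈ S := htop (by split_ifs <;> omega)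
  have hreg : (if d = 0 then (n : ℤ) - 2 * (p : ℤ) else (n : ℤ) - 2 * (p : ℤ) - 1) =
      (n : ℤ) - P := by
    rw [hP]
    split_ifs <;> push_cast <;> ring
  rw [pathIdeal_eq_squarefreeIdeal K hln hmn, ← hk, hreg, ← hP]
  have hhom := homogeneousComponent_mem_squarefreeIdeal (K := K) (cycleWindows l m n k)
  refine ⟨nonempty_minimalGradedFreeResolution _ hhom
    fun f hf => constantCoeff_eq_zero_of_mem_squarefreeIdeal ?_ hf, fun F => ?_⟩
  · rintro ⟨j, -, hj⟩
    have h := congrArg Finset.card hj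
    rw [cycleWindow_self, card_interval (injOn_cycleCoord l n j) hmn, Finset.card_empty] at h
    omega
  · have hPn : F.betti P n ≠ 0 := F.betti_ne_zero_of_isolated hhom hS htop fun i hi => by
      have := hb _ hi
      dsimp only at this
      omega
    refine ⟨⟨⟨n, hPn⟩, ?_⟩, ⟨⟨P, n, hPn, rfl⟩, ?_⟩⟩
    · rintro i ⟨j, hij⟩
      exact (hb _ (F.mem_of_betti_ne_zero hhom hS hij)).1
    · rintro _ ⟨i, j, hij, rfl⟩
      have := (hb _ (F.mem_of_betti_ne_zero hhom hS hij)).2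
      dsimp only at this
      omega

end Cycle
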